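/- **Linear tensor regression with a nonconvex low-tubal-rank penalty.** *Tensors.* For $\mathcal T\in\mathbb R^{d\times d\times d_3}$ let $\sigma_{1j}(\mathcal T)\ge\dots\ge\sigma_{dj}(\mathcal T)$ be the singular values of the $j$-th frontal slice of the (unnormalised) discrete Fourier transform of $\mathcal T$ along the third dimension, i.e. the diagonal entries of the t-SVD of $\mathcal T$ in the Fourier domain. Put ${\rm rank}_t(\mathcal T)=\#\{i:\exists j,\ \sigma_{ij}(\mathcal T)\neq0\}$, $\|\mathcal T\|_*=\frac1{d_3}\sum_{i,j}\sigma_{ij}(\mathcal T)$ and, for a univariate penalty $\rho_\lambda$, $\rho_\lambda(\mathcal T)=\frac1{d_3}\sum_{i,j}\rho_\lambda(\sigma_{ij}(\mathcal T))$. $\langle\cdot,\cdot\rangle$ and $\|\cdot\|_F$ are the entrywise inner product and the Frobenius norm. *Model.* $y_i=\langle\mathcal X_i,\mathcal B^0\rangle+\epsilon_i$, $i=1,\dots,n$ $(n\ge 1)$, where the pairs $(\mathcal X_i,\epsilon_i)$ are i.i.d., $\epsilon_i$ is independent of $\mathcal X_i$, $\epsilon_i\sim N(0,\sigma^2)$,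 $r={\rm rank}_t(\mathcal B^0)\ge1$, and $\mathcal X_i$ is $\nu$-sub-Gaussian: $\mathbb E\exp(\langle\mathcal X_i,\mathcal U\rangle^2/(2\nu^2))\le2$ for all $\|\mathcal U\|_F=1$. Let $L_n(\mathcal B)=\frac1{2n}\sum_i(y_i-\langle\mathcal X_i,\mathcal B\rangle)^2$ and $\mathbf H=\mathbb E\big[\frac1n\sum_i{\rm vec}(\mathcal X_i){\rm vec}(\mathcal X_i)^{\mathsf T}\big]$, with smallest eigenvalue $\Lambda_{\min}(\mathbf H)\ge\kappa>0$. *Penalty.* $\rho_\lambda:\mathbb R\to\mathbb R$ is continuous, even, $\rho_\lambda(0)=0$, concave and nondecreasing on $[0,\infty)$, $\rho_\lambda(x)/x$ is nonincreasing on $(0,\infty)$, $\rho_\lambda$ is differentiable off $0$ with $\lim_{t\to0^+}\rho_\lambda'(t)=\lambda C_{\rho'}$, $C_{\rho'}>0$, and $\rho_\lambda(x)+\frac\mu2x^2$ is convex for some $\mu>0$ with $3\mu<2\Lambda_{\min}(\mathbf H)$. *Claim.* There are absolute constants $C,c>0$; for all $\nu,\kappa,C_{\rho'}>0$, $\sigma\ge0$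 a constant $C_1>0$ depending only on these; and for every radius $\beta>0$ and every $A>0$ a constant $c_0>0$ depending only on $\nu,\kappa,C_{\rho'},\sigma,\beta,A$, such that the following holds. If $\lambda\ge c_0\sqrt{dd_3/n}$ (in particular if $\lambda\asymp\sqrt{dd_3/n}$ with lower constant at least $c_0$) and $n\ge C_1\,r\,d\,d_3/\beta^2$, then with probability at least $1-d_3e^{-Ad}$, every stationary point $\widehat{\mathcal B}$ of $L_n+\rho_\lambda$ (that is, $0\in\partial(L_n+\rho_\lambda)(\widehat{\mathcal B})$) with $\|\widehat{\mathcal B}-\mathcal B^0\|_F\le\beta$ satisfies $$\|\widehat{\mathcal B}-\mathcal B^0\|_F\le C\frac{C_{\rho'}\lambda\sqrt r}{2\Lambda_{\min}(\mathbf H)-3\mu},\qquad \|\widehat{\mathcal B}-\mathcal B^0\|_*\le C\frac{C_{\rho'}\lambda r}{2\Lambda_{\min}(\mathbf H)-3\mu},$$ $$\frac1n\sum_{i=1}^n\langle\mathcal X_i,\widehat{\mathcal B}-\mathcal B^0\rangle^2\le C_{\rho'}^2\lambda^2r\Big(\frac{c}{2\Lambda_{\min}(\mathbf H)-3\mu}+\frac{c\mu}{(2\Lambda_{\min}(\mathbf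 H)-3\mu)^2}\Big).$$ -/

import Mathlib

open MeasureTheory ProbabilityTheory Filter Topology
open scoped BigOperators NNReal ENNReal RealInnerProductSpace

noncomputable section

/-- Real third-order tensors of size `d × d × d₃`. The inner product is the entrywise one
and the norm is the Frobenius norm. -/
abbrev Tensor (d d₃ : ℕ) : Type := EuclideanSpace ℝ (Fin d × Fin d × Fin d₃)

namespace Tensor

variable {d d₃ : ℕ}

/-- The `j`-th frontal slice of the (unnormalised) discrete Fourier transform of `T` along the
third dimension. -/
def fourierSlice (T : Tensor d d₃) (j : Fin d₃) : Matrix (Fin d) (Fin d) ℂ :=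
  Matrix.of fun a b =>
    ∑ k : Fin d₃,
      Complex.exp (-(2 * (Real.pi : ℂ) * Complex.I * (j : ℕ) * (k : ℕ) / (d₃ : ℂ))) *
        ((T (a, b, k) : ℝ) : ℂ)

/-- The singular value `σ_{ij}` of `T` in the Fourier domain, that is, the `i`-th largest singular
value of the `j`-th Fourier slice. It is the entry `(i, i, j)` of the transformed f-diagonal factor
of the t-SVD of `T`, which is computed slice by slice. -/
def sv (T : Tensor d d₃) (i : Fin d) (j : Fin d₃) : ℝ :=
  (Matrix.toEuclideanLin (T.fourierSlice j)).singularValues (i : ℕ)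

/-- The tubal rank: the number of nonzero singular tubes of the t-SVD. (A tube vanishes iff its
Fourier transform does.) -/
def tubalRank (T : Tensor d d₃) : ℕ := Set.ncard {i : Fin d | ∃ j : Fin d₃, T.sv i j ≠ 0}

/-- The tensor tubal nuclear norm. -/
def nuclearNorm (T : Tensor d d₃) : ℝ := (1 / (d₃ : ℝ)) * ∑ i : Fin d, ∑ j : Fin d₃, T.sv i j

/-- The spectral regularizer induced by a univariate penalty `ρ`. -/
def regularizer (ρ : ℝ → ℝ) (T : Tensor d d₃) : ℝ :=
  (1 / (d₃ : ℝ)) * ∑ i : Fin d, ∑ j : Fin d₃, ρ (T.sv i j)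

end Tensor

/-- `ρ` is an admissible univariate penalty with tuning parameter `lam`, weak convexity
modulus `μ`, and slope `lam * Cρ` at `0⁺`. -/
structure IsPenalty (ρ : ℝ → ℝ) (lam μ Cρ : ℝ) : Prop where
  continuous : Continuous ρ
  concaveOn : ConcaveOn ℝ (Set.Ici 0) ρ
  even : ∀ x, ρ (-x) = ρ x
  map_zero : ρ 0 = 0
  monotoneOn : MonotoneOn ρ (Set.Ici 0)
  antitoneOn_div : AntitoneOn (fun x => ρ x / x) (Set.Ioi 0)
  differentiableAt : ∀ x, x ≠ 0 → DifferentiableAt ℝ ρ x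
  tendsto_deriv : Tendsto (deriv ρ) (𝓝[>] 0) (𝓝 (lam * Cρ))
  mu_pos : 0 < μ
  weaklyConvex : ConvexOn ℝ Set.univ (fun x => ρ x + μ / 2 * x ^ 2)

/-- `g` is a regular (Fréchet) subgradient of `F` at `x`:
`liminf_{y → x} (F y - F x - ⟪g, y - x⟫) / ‖y - x‖ ≥ 0`. -/
def IsRegularSubgradient {E : Type*} [NormedAddCommGroup E] [InnerProductSpace ℝ E]
    (F : E → ℝ) (x g : E) : Prop :=
  ∀ η : ℝ, 0 < η → ∀ᶠ y in 𝓝 x, F x + ⟪g, y - x⟫ - η * ‖y - x‖ ≤ F y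

/-- `x` is a stationary point of `F`: `0 ∈ ∂F(x)`. For functions that become convex after adding
a multiple of `‖·‖²`, as the objectives below do, the regular, limiting and
Clarke subdifferentials coincide. -/
def IsStationaryPoint {E : Type*} [NormedAddCommGroup E] [InnerProductSpace ℝ E]
    (F : E → ℝ) (x : E) : Prop :=
  IsRegularSubgradient F x 0

section Regression

variable {d d₃ n : ℕ} {Ω : Type*} [MeasurableSpace Ω]

/-- A random tensor is `ν`-sub-Gaussian: `‖⟨Z, u⟩‖_{ψ₂} ≤ √2 ν` for every unit tensor `u`. -/
def IsSubGaussianTensor (P : Measure Ω) (Z : Ω → Tensor d d₃) (ν : ℝ) : Prop :=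
  ∀ u : Tensor d d₃, ‖u‖ = 1 →
    ∫⁻ ω, ENNReal.ofReal (Real.exp (⟪Z ω, u⟫ ^ 2 / (2 * ν ^ 2))) ∂P ≤ 2

/-- The sample `(y_i, X_i)` follows the linear model `y_i = ⟨X_i, B₀⟩ + ε_i`, where the pairs
`(X_i, ε_i)` are i.i.d., `ε_i` is independent of `X_i` and `ε_i ∼ N(0, σ²)`. -/
structure IsLinearTensorSample (P : Measure Ω) (X : Fin n → Ω → Tensor d d₃)
    (y ε : Fin n → Ω → ℝ) (B₀ : Tensor d d₃) (σ : ℝ≥0) : Prop where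
  measurable_X : ∀ i, Measurable (X i)
  measurable_noise : ∀ i, Measurable (ε i)
  response : ∀ i ω, y i ω = ⟪X i ω, B₀⟫ + ε i ω
  indep : iIndepFun (fun i ω => (X i ω, ε i ω)) P
  identDistrib : ∀ i j,
    IdentDistrib (fun ω => (X i ω, ε i ω)) (fun ω => (X j ω, ε j ω)) P P
  indep_noise : ∀ i, IndepFun (X i) (ε i) P
  gaussian_noise : ∀ i, P.map (ε i) = gaussianReal 0 (σ ^ 2)

/-- The empirical squared-loss risk `L_n(B) = (1 / 2n) ∑ (y_i - ⟨X_i, B⟩)²`. -/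
def empiricalRisk (x : Fin n → Tensor d d₃) (y : Fin n → ℝ) (B : Tensor d d₃) : ℝ :=
  (1 / (2 * (n : ℝ))) * ∑ i, (y i - ⟪x i, B⟫) ^ 2

/-- The penalised objective `L_n(B) + ρ_λ(B)`. -/
def objective (x : Fin n → Tensor d d₃) (y : Fin n → ℝ) (ρ : ℝ → ℝ) (B : Tensor d d₃) : ℝ :=
  empiricalRisk x y B + B.regularizer ρ

/-- The Hessian `H_n = (1 / n) ∑ x_i x_iᵀ` of the empirical risk, with `x_i = vec(X_i)`. -/
def empiricalHessian (x : Fin n → Tensor d d₃) :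
    Matrix (Fin d × Fin d × Fin d₃) (Fin d × Fin d × Fin d₃) ℝ :=
  Matrix.of fun a b => (1 / (n : ℝ)) * ∑ i, x i a * x i b

/-- The population Hessian `H = 𝔼[H_n]`. -/
def populationHessian (P : Measure Ω) (X : Fin n → Ω → Tensor d d₃) :
    Matrix (Fin d × Fin d × Fin d₃) (Fin d × Fin d × Fin d₃) ℝ :=
  Matrix.of fun a b => ∫ ω, empiricalHessian (fun i => X i ω) a b ∂P

end Regression

/-- The smallest eigenvalue of a real symmetric matrix (of positive size). -/
def minEigenvalue {ι : Type*} [Fintype ι] [DecidableEq ι] (M : Matrix ι ι ℝ) : ℝ :=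
  sInf (spectrum ℝ M)

end

/-!
Write `Δ = B - B₀`. Stationarity together with weak convexity of the regularizer gives a basic
inequality between `‖Δ‖`, the nuclear norm of `Δ` and the mean square `n⁻¹ ∑ ⟪Xᵢ, Δ⟫²`, provided
the noise `⟪n⁻¹ ∑ εᵢ Xᵢ, Δ⟫` and the curvature deficit `⅔ Λ ‖Δ‖² - n⁻¹ ∑ ⟪Xᵢ, Δ⟫²` are both at most
a small multiple of `λ ‖Δ‖_*`. The nuclear norm ball is four times the convex hull of a net of
`d₃ exp(7 d)` rank-one atoms, so the noise is controlled by a union bound over the net. For the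
curvature, `T` in the hull is approximated by averages of `s ≍ n / d` atoms (Maurey's empirical
method): the quadratic form is bounded below on all such averages by a union bound, and passing to
`T` costs a term of order `(d d₃ / n) ‖T‖_*²`. On the ball `‖T‖ ≤ β` the deficit is bounded, so it
is also at most a multiple of the square root of that term, which is linear in `‖T‖_*`.
-/

/-! ### Spectral functions -/

section EvenConvex

variable {f : ℝ → ℝ}

theorem nonneg_of_convexOn_of_even (hf : ConvexOn ℝ Set.univ f) (he : Function.Even f)
    (h0 : f 0 = 0) (x : ℝ) : 0 ≤ f x := by
  have hmid := hf.2 (Set.mem_univ x) (Set.mem_univ (-x))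
    (by norm_num : (0 : ℝ) ≤ 1 / 2) (by norm_num : (0 : ℝ) ≤ 1 / 2) (by norm_num)
  simp only [smul_eq_mul, he x] at hmid
  rw [show (1 / 2 * x + 1 / 2 * -x : ℝ) = 0 by ring, h0] at hmid
  linarith

theorem map_sum_mul_le_of_convexOn_of_even (hf : ConvexOn ℝ Set.univ f) (he : Function.Even f)
    (h0 : f 0 = 0) {κ : Type*} [Fintype κ] (c s : κ → ℝ) (hc : ∑ k, |c k| ≤ 1) :
    f (∑ k, c k * s k) ≤ ∑ k, |c k| * f (s k) := by
  have jensen := hf.map_sum_le (t := (Finset.univ : Finset (Option κ)))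
    (w := fun o => o.elim (1 - ∑ k, |c k|) fun k => |c k|)
    (p := fun o => o.elim 0 fun k => SignType.sign (c k) * s k)
    (by
      rintro (_ | k) _
      · simpa using hc
      · exact abs_nonneg _)
    (by simp [Fintype.sum_option]) (fun _ _ => Set.mem_univ _)
  simp only [Fintype.sum_option, Option.elim, smul_eq_mul, mul_zero, h0, zero_add] at jensen
  have abs_mul_sign : ∀ k, |c k| * (SignType.sign (c k) * s k) = c k * s k := fun k => by
    rw [← mul_assoc, abs_mul_sign]
  have map_sign : ∀ k, |c k| * f (SignType.sign (c k) * s k) = |c k| * f (s k) := by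
    intro k
    rcases lt_trichotomy (c k) 0 with h | h | h
    · simp [sign_neg h, he (s k)]
    · simp [h]
    · simp [sign_pos h]
  simpa only [abs_mul_sign, map_sign] using jensen

theorem sum_map_sum_mul_le_of_convexOn_of_even (hf : ConvexOn ℝ Set.univ f)
    (he : Function.Even f) (h0 : f 0 = 0) {ι κ : Type*} [Fintype ι] [Fintype κ] (c : ι → κ → ℝ)
    (s : κ → ℝ) (hrow : ∀ i, ∑ k, |c i k| ≤ 1) (hcol : ∀ k, ∑ i, |c i k| ≤ 1) :
    ∑ i, f (∑ k, c i k * s k) ≤ ∑ k, f (s k) := by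
  calc ∑ i, f (∑ k, c i k * s k)
      ≤ ∑ i, ∑ k, |c i k| * f (s k) := Finset.sum_le_sum fun i _ =>
        map_sum_mul_le_of_convexOn_of_even hf he h0 (c i) s (hrow i)
    _ = ∑ k, (∑ i, |c i k|) * f (s k) := by
        rw [Finset.sum_comm]
        simp only [Finset.sum_mul]
    _ ≤ ∑ k, f (s k) := Finset.sum_le_sum fun k _ =>
        mul_le_of_le_one_left (nonneg_of_convexOn_of_even hf he h0 _) (hcol k)

end EvenConvex

section SpectralSum

variable {𝕜 E : Type*} [RCLike 𝕜] [NormedAddCommGroup E] [InnerProductSpace 𝕜 E]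
  [FiniteDimensional 𝕜 E]

/-- The spectral function `∑ k, f (σ_k(T))` of an endomorphism, over all `dim E` singular values. -/
noncomputable def spectralSum (f : ℝ → ℝ) (T : E →ₗ[𝕜] E) : ℝ :=
  ∑ k : Fin (Module.finrank 𝕜 E), f (T.singularValues k)

/-- The trace (Schatten 1-) norm, used to compare the tubal nuclear norms slice by slice. -/
noncomputable def traceNorm (T : E →ₗ[𝕜] E) : ℝ := spectralSum (fun s => s) T

/-- The indices of the nonzero singular values. -/
noncomputable def singularSupport (T : E →ₗ[𝕜] E) : Finset (Fin (Module.finrank 𝕜 E)) :=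
  Finset.univ.filter fun k => T.singularValues k ≠ 0

/-- The orthonormal bases `u`, `v` are left and right singular vectors of `T`. -/
def IsSingularSystem (T : E →ₗ[𝕜] E) (u v : OrthonormalBasis (Fin (Module.finrank 𝕜 E)) 𝕜 E) :
    Prop :=
  ∀ i, T (v i) = ((T.singularValues i : ℝ) : 𝕜) • u i

theorem spectralSum_eq_sum {d : ℕ} (hd : Module.finrank 𝕜 E = d) (f : ℝ → ℝ) (T : E →ₗ[𝕜] E) :
    spectralSum f T = ∑ k : Fin d, f (T.singularValues k) := by
  subst hd
  rfl

theorem traceNorm_eq_spectralSum_abs (T : E →ₗ[𝕜] E) : traceNorm T = spectralSum (|·|) T := by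
  simp only [traceNorm, spectralSum, abs_of_nonneg (T.singularValues_nonneg _)]

theorem spectralSum_add (f g : ℝ → ℝ) (T : E →ₗ[𝕜] E) :
    spectralSum (fun x => f x + g x) T = spectralSum f T + spectralSum g T :=
  Finset.sum_add_distrib

theorem spectralSum_const_mul (c : ℝ) (f : ℝ → ℝ) (T : E →ₗ[𝕜] E) :
    spectralSum (fun x => c * f x) T = c * spectralSum f T :=
  (Finset.mul_sum _ _ _).symm

@[simp]
theorem mem_singularSupport {T : E →ₗ[𝕜] E} {k : Fin (Module.finrank 𝕜 E)} :
    k ∈ singularSupport T ↔ T.singularValues k ≠ 0 := by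
  simp only [singularSupport, Finset.mem_filter, Finset.mem_univ, true_and]

theorem spectralSum_eq_sum_singularSupport {f : ℝ → ℝ} (h0 : f 0 = 0) (T : E →ₗ[𝕜] E) :
    spectralSum f T = ∑ k ∈ singularSupport T, f (T.singularValues k) := by
  refine (Finset.sum_filter_of_ne fun k _ hk => ?_).symm
  contrapose! hk
  rw [hk, h0]

theorem card_singularSupport (T : E →ₗ[𝕜] E) :
    (singularSupport T).card = Module.finrank 𝕜 T.range := by
  rw [← T.card_support_singularValues]
  refine Finset.card_bij (fun k _ => (k : ℕ)) (fun k hk => ?_) (fun i _ j _ h => Fin.ext h) ?_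
  · exact Finsupp.mem_support_iff.mpr (mem_singularSupport.mp hk)
  · intro k hk
    have hσ := Finsupp.mem_support_iff.mp hk
    have hlt : k < Module.finrank 𝕜 E := by
      by_contra h
      exact hσ (T.singularValues_of_finrank_le (not_lt.mp h))
    exact ⟨⟨k, hlt⟩, mem_singularSupport.mpr hσ, rfl⟩

theorem exists_isSingularSystem (T : E →ₗ[𝕜] E) : ∃ u v, IsSingularSystem T u v := by
  let v := T.isSymmetric_adjoint_comp_self.eigenvectorBasis rfl
  have hTv : ∀ i j, inner 𝕜 (T (v i)) (T (v j)) =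
      ((T.singularValues i ^ 2 : ℝ) : 𝕜) * inner 𝕜 (v i) (v j) := by
    intro i j
    have heigen := T.isSymmetric_adjoint_comp_self.apply_eigenvectorBasis rfl i
    rw [LinearMap.comp_apply] at heigen
    rw [← LinearMap.adjoint_inner_left, heigen, inner_smul_left, T.sq_singularValues_fin rfl]
    simp [v]
  let S : Set (Fin (Module.finrank 𝕜 E)) := {i | T.singularValues i ≠ 0}
  let w : Fin (Module.finrank 𝕜 E) → E := fun i => ((T.singularValues i : ℝ) : 𝕜)⁻¹ • T (v i)
  have hw : Orthonormal 𝕜 (S.domRestrict w) := by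
    rw [orthonormal_iff_ite]
    rintro ⟨i, hi⟩ ⟨j, hj⟩
    change inner 𝕜 (w i) (w j) = _
    have hσ : ((T.singularValues i : ℝ) : 𝕜) ≠ 0 := by exact_mod_cast hi
    simp only [w, inner_smul_left, inner_smul_right, hTv, Subtype.mk.injEq]
    rw [orthonormal_iff_ite.mp v.orthonormal i j]
    split_ifs with h
    · subst h
      simp only [map_inv₀, RCLike.conj_ofReal]
      push_cast
      field_simp
    · simp
  obtain ⟨u, hu⟩ := hw.exists_orthonormalBasis_extension_of_card_eq (by simp)
  refine ⟨u, v, fun i => ?_⟩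
  by_cases hi : T.singularValues i = 0
  · have hzero := hTv i i
    rw [hi, zero_pow two_ne_zero, RCLike.ofReal_zero, zero_mul, inner_self_eq_zero] at hzero
    rw [hi, RCLike.ofReal_zero, zero_smul, hzero]
  · have hσ : ((T.singularValues i : ℝ) : 𝕜) ≠ 0 := by exact_mod_cast hi
    rw [hu i hi, smul_smul, mul_inv_cancel₀ hσ, one_smul]

namespace IsSingularSystem

variable {T : E →ₗ[𝕜] E} {u v : OrthonormalBasis (Fin (Module.finrank 𝕜 E)) 𝕜 E}

theorem inner_apply (h : IsSingularSystem T u v) (i : Fin (Module.finrank 𝕜 E)) :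
    inner 𝕜 (u i) (T (v i)) = ((T.singularValues i : ℝ) : 𝕜) := by
  rw [h, inner_smul_right, inner_self_eq_norm_sq_to_K, u.orthonormal.norm_eq_one]
  simp

theorem adjoint_apply (h : IsSingularSystem T u v) (i : Fin (Module.finrank 𝕜 E)) :
    LinearMap.adjoint T (u i) = ((T.singularValues i : ℝ) : 𝕜) • v i := by
  refine InnerProductSpace.ext_inner_right_basis v.toBasis fun l => ?_
  rw [OrthonormalBasis.coe_toBasis, LinearMap.adjoint_inner_left, h, inner_smul_right,
    inner_smul_left, orthonormal_iff_ite.mp u.orthonormal, orthonormal_iff_ite.mp v.orthonormal]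
  split_ifs with hil
  · simp [hil]
  · simp

theorem left_mem_range (h : IsSingularSystem T u v) {i : Fin (Module.finrank 𝕜 E)}
    (hi : T.singularValues i ≠ 0) : u i ∈ T.range := by
  have hσ : ((T.singularValues i : ℝ) : 𝕜) ≠ 0 := by exact_mod_cast hi
  rw [← inv_smul_smul₀ hσ (u i), ← h i, ← map_smul]
  exact T.mem_range_self _

theorem right_mem_ker_orthogonal (h : IsSingularSystem T u v) {i : Fin (Module.finrank 𝕜 E)}
    (hi : T.singularValues i ≠ 0) : v i ∈ T.kerᗮ := by
  have hσ : ((T.singularValues i : ℝ) : 𝕜) ≠ 0 := by exact_mod_cast hi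
  rw [← inv_smul_smul₀ hσ (v i), ← h.adjoint_apply i, Submodule.mem_orthogonal']
  intro x hx
  rw [inner_smul_left, LinearMap.adjoint_inner_left, LinearMap.mem_ker.mp hx, inner_zero_right,
    mul_zero]

end IsSingularSystem

theorem sum_map_re_inner_le_spectralSum {f : ℝ → ℝ} (hf : ConvexOn ℝ Set.univ f)
    (he : Function.Even f) (h0 : f 0 = 0) {ι : Type*} [Fintype ι] {a b : ι → E}
    (ha : Orthonormal 𝕜 a) (hb : Orthonormal 𝕜 b) (T : E →ₗ[𝕜] E) :
    ∑ i, f (RCLike.re (inner 𝕜 (a i) (T (b i)))) ≤ spectralSum f T := by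
  obtain ⟨u, v, huv⟩ := exists_isSingularSystem T
  let c : ι → Fin (Module.finrank 𝕜 E) → ℝ :=
    fun i k => RCLike.re (inner 𝕜 (v k) (b i) * inner 𝕜 (a i) (u k))
  have re_inner_eq : ∀ i, RCLike.re (inner 𝕜 (a i) (T (b i))) =
      ∑ k, c i k * T.singularValues k := by
    intro i
    conv_lhs => rw [← v.sum_repr' (b i), map_sum, inner_sum, map_sum]
    refine Finset.sum_congr rfl fun k _ => ?_
    rw [map_smul, huv, inner_smul_right, inner_smul_right, ← RCLike.re_mul_ofReal]
    ring_nf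
  have abs_le : ∀ i k,
      |c i k| ≤ (‖inner 𝕜 (b i) (v k)‖ ^ 2 + ‖inner 𝕜 (a i) (u k)‖ ^ 2) / 2 := by
    intro i k
    refine (RCLike.abs_re_le_norm _).trans ?_
    rw [norm_mul, norm_inner_symm (v k)]
    nlinarith [sq_nonneg (‖inner 𝕜 (b i) (v k)‖ - ‖inner 𝕜 (a i) (u k)‖)]
  simp only [re_inner_eq]
  refine sum_map_sum_mul_le_of_convexOn_of_even hf he h0 c _ (fun i => ?_) fun k => ?_
  · refine (Finset.sum_le_sum fun k _ => abs_le i k).trans ?_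
    rw [← Finset.sum_div, Finset.sum_add_distrib, v.sum_sq_norm_inner_left,
      u.sum_sq_norm_inner_left, ha.norm_eq_one, hb.norm_eq_one]
    norm_num
  · refine (Finset.sum_le_sum fun i _ => abs_le i k).trans ?_
    rw [← Finset.sum_div, Finset.sum_add_distrib]
    have bessel_b := hb.sum_inner_products_le (v k) (s := Finset.univ)
    have bessel_a := ha.sum_inner_products_le (u k) (s := Finset.univ)
    simp only [v.orthonormal.norm_eq_one, u.orthonormal.norm_eq_one] at bessel_b bessel_a
    linarith

theorem convexOn_spectralSum {f : ℝ → ℝ} (hf : ConvexOn ℝ Set.univ f)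
    (he : Function.Even f) (h0 : f 0 = 0) (S T : E →ₗ[𝕜] E) {s t : ℝ} (hs : 0 ≤ s) (ht : 0 ≤ t)
    (hst : s + t = 1) :
    spectralSum f ((s : 𝕜) • S + (t : 𝕜) • T) ≤ s * spectralSum f S + t * spectralSum f T := by
  obtain ⟨u, v, huv⟩ := exists_isSingularSystem ((s : 𝕜) • S + (t : 𝕜) • T)
  have hS := sum_map_re_inner_le_spectralSum hf he h0 u.orthonormal v.orthonormal S
  have hT := sum_map_re_inner_le_spectralSum hf he h0 u.orthonormal v.orthonormal T
  have hσ : ∀ k : Fin (Module.finrank 𝕜 E), ((s : 𝕜) • S + (t : 𝕜) • T).singularValues k =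
      s • RCLike.re (inner 𝕜 (u k) (S (v k))) + t • RCLike.re (inner 𝕜 (u k) (T (v k))) := by
    intro k
    have h := congrArg RCLike.re (huv.inner_apply k)
    rw [RCLike.ofReal_re] at h
    simp [← h, inner_add_right, inner_smul_right]
  calc spectralSum f ((s : 𝕜) • S + (t : 𝕜) • T)
      ≤ ∑ k, (s * f (RCLike.re (inner 𝕜 (u k) (S (v k)))) +
          t * f (RCLike.re (inner 𝕜 (u k) (T (v k))))) :=
        Finset.sum_le_sum fun k _ => by
          rw [hσ k]
          exact hf.2 (Set.mem_univ _) (Set.mem_univ _) hs ht hst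
    _ ≤ s * spectralSum f S + t * spectralSum f T := by
        rw [Finset.sum_add_distrib, ← Finset.mul_sum, ← Finset.mul_sum]
        gcongr

theorem sum_re_inner_le_traceNorm {ι : Type*} [Fintype ι] {a b : ι → E}
    (ha : Orthonormal 𝕜 a) (hb : Orthonormal 𝕜 b) (T : E →ₗ[𝕜] E) :
    ∑ i, RCLike.re (inner 𝕜 (a i) (T (b i))) ≤ traceNorm T := by
  rw [traceNorm_eq_spectralSum_abs]
  exact (Finset.sum_le_sum fun i _ => le_abs_self _).trans <| sum_map_re_inner_le_spectralSum
    (convexOn_norm (E := ℝ) convex_univ) (fun x => abs_neg x) abs_zero ha hb T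

theorem traceNorm_add_le (S T : E →ₗ[𝕜] E) : traceNorm (S + T) ≤ traceNorm S + traceNorm T := by
  obtain ⟨u, v, huv⟩ := exists_isSingularSystem (S + T)
  calc traceNorm (S + T)
      = ∑ i, (RCLike.re (inner 𝕜 (u i) (S (v i))) + RCLike.re (inner 𝕜 (u i) (T (v i)))) := by
        rw [traceNorm, spectralSum]
        refine Finset.sum_congr rfl fun i _ => ?_
        rw [← map_add, ← inner_add_right, ← LinearMap.add_apply, huv.inner_apply,
          RCLike.ofReal_re]
    _ ≤ traceNorm S + traceNorm T := by
        rw [Finset.sum_add_distrib]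
        exact add_le_add (sum_re_inner_le_traceNorm u.orthonormal v.orthonormal S)
          (sum_re_inner_le_traceNorm u.orthonormal v.orthonormal T)

/-! ### The Hilbert-Schmidt norm -/

theorem sum_sq_norm_apply_eq_adjoint {ι κ : Type*} [Fintype ι] [Fintype κ]
    (T : E →ₗ[𝕜] E) (e : OrthonormalBasis ι 𝕜 E) (u : OrthonormalBasis κ 𝕜 E) :
    ∑ i, ‖T (e i)‖ ^ 2 = ∑ k, ‖LinearMap.adjoint T (u k)‖ ^ 2 := by
  simp_rw [← u.sum_sq_norm_inner_right (T (e _)),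
    ← e.sum_sq_norm_inner_left (LinearMap.adjoint T (u _)), LinearMap.adjoint_inner_left]
  exact Finset.sum_comm

theorem sum_sq_norm_apply_eq_spectralSum {ι : Type*} [Fintype ι] (T : E →ₗ[𝕜] E)
    (e : OrthonormalBasis ι 𝕜 E) : ∑ i, ‖T (e i)‖ ^ 2 = spectralSum (· ^ 2) T := by
  obtain ⟨u, v, huv⟩ := exists_isSingularSystem T
  rw [sum_sq_norm_apply_eq_adjoint T e u]
  refine Finset.sum_congr rfl fun k _ => ?_
  rw [huv.adjoint_apply, norm_smul, v.orthonormal.norm_eq_one, mul_one, RCLike.norm_ofReal,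
    sq_abs]

theorem spectralSum_sq_adjoint (T : E →ₗ[𝕜] E) :
    spectralSum (· ^ 2) (LinearMap.adjoint T) = spectralSum (· ^ 2) T := by
  have e := stdOrthonormalBasis 𝕜 E
  rw [← sum_sq_norm_apply_eq_spectralSum T e, ← sum_sq_norm_apply_eq_spectralSum _ e,
    sum_sq_norm_apply_eq_adjoint T e e]

theorem spectralSum_sq_comp_le {S : E →ₗ[𝕜] E} (hS : ∀ x, ‖S x‖ ≤ ‖x‖) (T : E →ₗ[𝕜] E) :
    spectralSum (· ^ 2) (S ∘ₗ T) ≤ spectralSum (· ^ 2) T := by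
  have e := stdOrthonormalBasis 𝕜 E
  rw [← sum_sq_norm_apply_eq_spectralSum _ e, ← sum_sq_norm_apply_eq_spectralSum _ e]
  exact Finset.sum_le_sum fun i _ => pow_le_pow_left₀ (norm_nonneg _) (hS _) 2

theorem spectralSum_sq_comp_starProjection_le (T : E →ₗ[𝕜] E) (K : Submodule 𝕜 E) :
    spectralSum (· ^ 2) (T ∘ₗ (K.starProjection : E →ₗ[𝕜] E)) ≤ spectralSum (· ^ 2) T := by
  have hadj : LinearMap.adjoint (K.starProjection : E →ₗ[𝕜] E) = K.starProjection :=
    K.starProjection_isSymmetric.adjoint_eq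
  rw [← spectralSum_sq_adjoint, LinearMap.adjoint_comp, hadj, ← spectralSum_sq_adjoint T]
  exact spectralSum_sq_comp_le (fun x => K.norm_starProjection_apply_le x) _

theorem sum_le_sqrt_card_mul_sqrt_sum_sq {κ : Type*} [Fintype κ] (I : Finset κ) (g : κ → ℝ) :
    ∑ i ∈ I, g i ≤ √(I.card : ℝ) * √(∑ i, g i ^ 2) := by
  have cauchy := Real.sum_mul_le_sqrt_mul_sqrt I (fun _ => 1) g
  simp only [one_mul, one_pow, Finset.sum_const, nsmul_eq_mul, mul_one] at cauchy
  refine cauchy.trans ?_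
  gcongr
  exact Finset.subset_univ I

theorem traceNorm_le_sqrt_finrank_range_mul (T : E →ₗ[𝕜] E) :
    traceNorm T ≤ √(Module.finrank 𝕜 T.range) * √(spectralSum (· ^ 2) T) := by
  rw [traceNorm, spectralSum_eq_sum_singularSupport rfl, ← card_singularSupport T]
  exact sum_le_sqrt_card_mul_sqrt_sum_sq _ _

theorem sum_abs_re_inner_apply_le {ι : Type*} [Fintype ι] (u v : OrthonormalBasis ι 𝕜 E)
    (T : E →ₗ[𝕜] E) (I : Finset ι) :
    ∑ i ∈ I, |RCLike.re (inner 𝕜 (u i) (T (v i)))| ≤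
      √(I.card : ℝ) * √(spectralSum (· ^ 2) T) := by
  rw [← sum_sq_norm_apply_eq_spectralSum T v]
  refine (Finset.sum_le_sum fun i _ => ?_).trans (sum_le_sqrt_card_mul_sqrt_sum_sq I _)
  calc |RCLike.re (inner 𝕜 (u i) (T (v i)))| ≤ ‖inner 𝕜 (u i) (T (v i))‖ :=
        RCLike.abs_re_le_norm _
    _ ≤ ‖u i‖ * ‖T (v i)‖ := norm_inner_le_norm _ _
    _ = ‖T (v i)‖ := by rw [u.orthonormal.norm_eq_one, one_mul]

theorem IsSingularSystem.spectralSum_sq_add {A : E →ₗ[𝕜] E}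
    {u v : OrthonormalBasis (Fin (Module.finrank 𝕜 E)) 𝕜 E} (h : IsSingularSystem A u v)
    (M : E →ₗ[𝕜] E) :
    spectralSum (· ^ 2) (A + M) = spectralSum (· ^ 2) A +
      2 * ∑ i : Fin (Module.finrank 𝕜 E), A.singularValues i * RCLike.re (inner 𝕜 (u i) (M (v i))) +
        spectralSum (· ^ 2) M := by
  rw [← sum_sq_norm_apply_eq_spectralSum (A + M) v, ← sum_sq_norm_apply_eq_spectralSum M v,
    spectralSum, Finset.mul_sum, ← Finset.sum_add_distrib, ← Finset.sum_add_distrib]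
  refine Finset.sum_congr rfl fun k _ => ?_
  rw [LinearMap.add_apply, @norm_add_sq 𝕜, h, norm_smul, u.orthonormal.norm_eq_one,
    inner_smul_left]
  simp

theorem sum_re_inner_apply_eq {ι κ : Type*} [Fintype ι] [Fintype κ] (S T : E →ₗ[𝕜] E)
    (e : OrthonormalBasis ι 𝕜 E) (v : OrthonormalBasis κ 𝕜 E) :
    ∑ i, RCLike.re (inner 𝕜 (S (e i)) (T (e i))) =
      ∑ k, RCLike.re (inner 𝕜 (S (v k)) (T (v k))) := by
  simp_rw [re_inner_eq_norm_add_mul_self_sub_norm_mul_self_sub_norm_mul_self_div_two,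
    ← Finset.sum_div, Finset.sum_sub_distrib, ← sq, ← LinearMap.add_apply,
    sum_sq_norm_apply_eq_spectralSum]

theorem sum_re_inner_apply_le_mul_traceNorm {ι : Type*} [Fintype ι] {S : E →ₗ[𝕜] E} {c : ℝ}
    (hS : ∀ u v : E, ‖u‖ = 1 → ‖v‖ = 1 → RCLike.re (inner 𝕜 u (S v)) ≤ c) (T : E →ₗ[𝕜] E)
    (e : OrthonormalBasis ι 𝕜 E) :
    ∑ i, RCLike.re (inner 𝕜 (S (e i)) (T (e i))) ≤ c * traceNorm T := by
  obtain ⟨u, v, huv⟩ := exists_isSingularSystem T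
  rw [sum_re_inner_apply_eq S T e v, traceNorm, spectralSum, Finset.mul_sum]
  refine Finset.sum_le_sum fun k _ => ?_
  rw [huv, inner_smul_right, RCLike.re_ofReal_mul, mul_comm, inner_re_symm]
  exact mul_le_mul_of_nonneg_right
    (hS _ _ (u.orthonormal.norm_eq_one k) (v.orthonormal.norm_eq_one k))
    (T.singularValues_nonneg k)

end SpectralSum

/-! ### Spectral penalties near a low-rank operator -/

theorem orthonormal_sumElim {𝕜 E : Type*} [RCLike 𝕜] [NormedAddCommGroup E]
    [InnerProductSpace 𝕜 E] {ι κ : Type*} {a : ι → E} {b : κ → E} (ha : Orthonormal 𝕜 a)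
    (hb : Orthonormal 𝕜 b) (hab : ∀ i k, inner 𝕜 (a i) (b k) = 0) :
    Orthonormal 𝕜 (Sum.elim a b) := by
  refine ⟨?_, ?_⟩
  · rintro (i | k)
    exacts [ha.norm_eq_one i, hb.norm_eq_one k]
  · rintro (i | k) (j | l) hne
    · exact ha.inner_eq_zero fun h => hne (congrArg _ h)
    · exact hab i l
    · exact inner_eq_zero_symm.mp (hab j k)
    · exact hb.inner_eq_zero fun h => hne (congrArg _ h)

section NormalPart

variable {𝕜 E : Type*} [RCLike 𝕜] [NormedAddCommGroup E] [InnerProductSpace 𝕜 E]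
  [FiniteDimensional 𝕜 E]

/-- The part of `M` normal at `A` to the operators of the same rank as `A`: it is cut down to
`ker A` on the right and to the orthogonal complement of the range of `A` on the left. -/
noncomputable def normalPart (A M : E →ₗ[𝕜] E) : E →ₗ[𝕜] E :=
  (A.rangeᗮ.starProjection : E →ₗ[𝕜] E) ∘ₗ M ∘ₗ (A.ker.starProjection : E →ₗ[𝕜] E)

theorem normalPart_add_tangent_eq (A M : E →ₗ[𝕜] E) :
    normalPart A M + ((A.range.starProjection : E →ₗ[𝕜] E) ∘ₗ M +
      (A.rangeᗮ.starProjection : E →ₗ[𝕜] E) ∘ₗ M ∘ₗ (A.kerᗮ.starProjection : E →ₗ[𝕜] E)) = M := by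
  ext x
  have hker := A.ker.starProjection_orthogonal_val x
  have hrange := A.range.starProjection_orthogonal_val (M x)
  simp only [normalPart, LinearMap.add_apply, LinearMap.comp_apply, ContinuousLinearMap.coe_coe,
    hker, map_sub, hrange]
  abel

theorem normalPart_apply_eq_zero {A : E →ₗ[𝕜] E} (M : E →ₗ[𝕜] E) {x : E} (hx : x ∈ A.kerᗮ) :
    normalPart A M x = 0 := by
  have hproj : A.ker.starProjection x = 0 :=
    (Submodule.starProjection_apply_eq_zero_iff _).mpr hx
  simp [normalPart, hproj]

theorem range_normalPart_le (A M : E →ₗ[𝕜] E) : (normalPart A M).range ≤ A.rangeᗮ := by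
  rintro _ ⟨x, rfl⟩
  exact A.rangeᗮ.starProjection_apply_mem _

theorem finrank_range_comp_starProjection_ker_orthogonal_le (A S : E →ₗ[𝕜] E) :
    Module.finrank 𝕜 (S ∘ₗ (A.kerᗮ.starProjection : E →ₗ[𝕜] E)).range ≤
      Module.finrank 𝕜 A.range := by
  rw [LinearMap.range_comp, Submodule.range_starProjection]
  have hrank := A.finrank_range_add_finrank_ker
  have hcompl := A.ker.finrank_add_finrank_orthogonal
  have hmap := Submodule.finrank_map_le S A.kerᗮ
  omega

theorem finrank_range_starProjection_comp_le (K : Submodule 𝕜 E) (S : E →ₗ[𝕜] E) :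
    Module.finrank 𝕜 ((K.starProjection : E →ₗ[𝕜] E) ∘ₗ S).range ≤ Module.finrank 𝕜 K := by
  refine Submodule.finrank_mono ?_
  rintro _ ⟨x, rfl⟩
  exact K.starProjection_apply_mem _

theorem traceNorm_le_traceNorm_normalPart_add (A M : E →ₗ[𝕜] E) :
    traceNorm M ≤ traceNorm (normalPart A M) +
      2 * (√(Module.finrank 𝕜 A.range) * √(spectralSum (· ^ 2) M)) := by
  set r := Module.finrank 𝕜 A.range
  have traceNorm_le : ∀ S : E →ₗ[𝕜] E, Module.finrank 𝕜 S.range ≤ r →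
      spectralSum (· ^ 2) S ≤ spectralSum (· ^ 2) M →
      traceNorm S ≤ √r * √(spectralSum (· ^ 2) M) := fun S hrank hsq =>
    (traceNorm_le_sqrt_finrank_range_mul S).trans (by gcongr)
  have range_part := traceNorm_le _ (finrank_range_starProjection_comp_le A.range M)
    (spectralSum_sq_comp_le (fun x => A.range.norm_starProjection_apply_le x) M)
  have ker_part := traceNorm_le _ (finrank_range_comp_starProjection_ker_orthogonal_le A
      ((A.rangeᗮ.starProjection : E →ₗ[𝕜] E) ∘ₗ M))
    ((spectralSum_sq_comp_starProjection_le _ _).trans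
      (spectralSum_sq_comp_le (fun x => A.rangeᗮ.norm_starProjection_apply_le x) M))
  calc traceNorm M ≤ traceNorm (normalPart A M) + (traceNorm _ + traceNorm _) := by
        conv_lhs => rw [← normalPart_add_tangent_eq A M]
        exact (traceNorm_add_le _ _).trans (add_le_add_right (traceNorm_add_le _ _) _)
    _ ≤ _ := by
        rw [LinearMap.comp_assoc] at ker_part
        linarith

namespace IsSingularSystem

variable {A M : E →ₗ[𝕜] E} {u v p q : OrthonormalBasis (Fin (Module.finrank 𝕜 E)) 𝕜 E}
  {k : Fin (Module.finrank 𝕜 E)}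

theorem left_mem_range_orthogonal (h : IsSingularSystem (normalPart A M) p q)
    (hk : (normalPart A M).singularValues k ≠ 0) : p k ∈ A.rangeᗮ :=
  range_normalPart_le A M (h.left_mem_range hk)

theorem right_mem_ker (h : IsSingularSystem (normalPart A M) p q)
    (hk : (normalPart A M).singularValues k ≠ 0) : q k ∈ A.ker := by
  rw [← A.ker.orthogonal_orthogonal]
  refine Submodule.orthogonal_le (fun x hx => ?_) (h.right_mem_ker_orthogonal hk)
  exact normalPart_apply_eq_zero M hx

theorem inner_add_apply_of_normalPart (h : IsSingularSystem (normalPart A M) p q)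
    (hk : (normalPart A M).singularValues k ≠ 0) :
    inner 𝕜 (p k) ((A + M) (q k)) = (((normalPart A M).singularValues k : ℝ) : 𝕜) := by
  have hq := h.right_mem_ker hk
  have hp := h.left_mem_range_orthogonal hk
  rw [LinearMap.add_apply, LinearMap.mem_ker.mp hq, zero_add, ← h.inner_apply k]
  simp only [normalPart, LinearMap.comp_apply, ContinuousLinearMap.coe_coe,
    Submodule.starProjection_eq_self_iff.mpr hq]
  rw [← A.rangeᗮ.inner_starProjection_left_eq_right, Submodule.starProjection_eq_self_iff.mpr hp]

/-- The singular vectors of `A` and of `normalPart A M` are mutually orthogonal, so together they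
are admissible test families for `A + M`. -/
theorem sum_map_add_spectralSum_normalPart_le (h : IsSingularSystem A u v) (M : E →ₗ[𝕜] E)
    {f : ℝ → ℝ} (hf : ConvexOn ℝ Set.univ f) (he : Function.Even f) (h0 : f 0 = 0) :
    ∑ i ∈ singularSupport A,
        f (A.singularValues i + RCLike.re (inner 𝕜 (u i) (M (v i)))) +
      spectralSum f (normalPart A M) ≤ spectralSum f (A + M) := by
  obtain ⟨p, q, hpq⟩ := exists_isSingularSystem (normalPart A M)
  let I := singularSupport A
  let J := singularSupport (normalPart A M)
  have hleft : Orthonormal 𝕜 (Sum.elim (fun i : I => u i) fun k : J => p k) := by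
    refine orthonormal_sumElim (u.orthonormal.comp _ Subtype.val_injective)
      (p.orthonormal.comp _ Subtype.val_injective) fun i k => ?_
    exact Submodule.inner_right_of_mem_orthogonal (h.left_mem_range (mem_singularSupport.mp i.2))
      (hpq.left_mem_range_orthogonal (mem_singularSupport.mp k.2))
  have hright : Orthonormal 𝕜 (Sum.elim (fun i : I => v i) fun k : J => q k) := by
    refine orthonormal_sumElim (v.orthonormal.comp _ Subtype.val_injective)
      (q.orthonormal.comp _ Subtype.val_injective) fun i k => ?_
    exact Submodule.inner_left_of_mem_orthogonal (hpq.right_mem_ker (mem_singularSupport.mp k.2))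
      (h.right_mem_ker_orthogonal (mem_singularSupport.mp i.2))
  have test := sum_map_re_inner_le_spectralSum hf he h0 hleft hright (A + M)
  rw [Fintype.sum_sum_type] at test
  simp only [Sum.elim_inl, Sum.elim_inr] at test
  rw [spectralSum_eq_sum_singularSupport h0 (normalPart A M)]
  refine le_trans (le_of_eq ?_) test
  congr 1
  · rw [← Finset.sum_coe_sort]
    refine Finset.sum_congr rfl fun i _ => ?_
    rw [LinearMap.add_apply, inner_add_right, h.inner_apply, map_add, RCLike.ofReal_re]
  · rw [← Finset.sum_coe_sort]
    refine Finset.sum_congr rfl fun k _ => ?_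
    rw [hpq.inner_add_apply_of_normalPart (mem_singularSupport.mp k.2), RCLike.ofReal_re]

end IsSingularSystem

theorem spectralSum_add_cross_sub_le_sum_singularSupport (A M : E →ₗ[𝕜] E)
    (u v : OrthonormalBasis (Fin (Module.finrank 𝕜 E)) 𝕜 E) {ρ : ℝ → ℝ} {μ L : ℝ}
    (hμ : 0 ≤ μ) (hL : 0 ≤ L) (h0 : ρ 0 = 0) (hlip : ∀ x y, ρ x - ρ y ≤ L * |x - y|) :
    spectralSum (fun x => ρ x + μ / 2 * x ^ 2) A +
        μ * ∑ i : Fin (Module.finrank 𝕜 E),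
          A.singularValues i * RCLike.re (inner 𝕜 (u i) (M (v i))) -
        L * (√(Module.finrank 𝕜 A.range) * √(spectralSum (· ^ 2) M)) ≤
      ∑ i ∈ singularSupport A, (fun x => ρ x + μ / 2 * x ^ 2)
        (A.singularValues i + RCLike.re (inner 𝕜 (u i) (M (v i)))) := by
  set δ := fun i => RCLike.re (inner 𝕜 (u i) (M (v i)))
  have hcross : ∑ i : Fin (Module.finrank 𝕜 E), A.singularValues i * δ i =
      ∑ i ∈ singularSupport A, A.singularValues i * δ i :=
    (Finset.sum_filter_of_ne fun i _ hi => left_ne_zero_of_mul hi).symm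
  have hterm : ∀ i ∈ singularSupport A,
      (ρ (A.singularValues i) + μ / 2 * A.singularValues i ^ 2) +
        μ * (A.singularValues i * δ i) - L * |δ i| ≤
      ρ (A.singularValues i + δ i) + μ / 2 * (A.singularValues i + δ i) ^ 2 := by
    intro i _
    have hρ := hlip (A.singularValues i) (A.singularValues i + δ i)
    rw [sub_add_cancel_left, abs_neg] at hρ
    nlinarith [mul_nonneg hμ (sq_nonneg (δ i))]
  have hδ_sum := sum_abs_re_inner_apply_le u v M (singularSupport A)
  rw [card_singularSupport] at hδ_sum
  refine le_trans ?_ (Finset.sum_le_sum hterm)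
  rw [Finset.sum_sub_distrib, Finset.sum_add_distrib, ← Finset.mul_sum, ← Finset.mul_sum,
    spectralSum_eq_sum_singularSupport (by simp [h0]), hcross]
  gcongr

theorem spectralSum_sub_spectralSum_add_le {ρ : ℝ → ℝ} {μ L : ℝ} (hμ : 0 ≤ μ) (hL : 0 ≤ L)
    (hconvex : ConvexOn ℝ Set.univ fun x => ρ x + μ / 2 * x ^ 2) (he : Function.Even ρ)
    (h0 : ρ 0 = 0) (hlip : ∀ x y, ρ x - ρ y ≤ L * |x - y|)
    (hlow : ∀ x, 0 ≤ x → L * x ≤ ρ x + μ / 2 * x ^ 2) (A M : E →ₗ[𝕜] E) :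
    spectralSum ρ A - spectralSum ρ (A + M) ≤
      L * (3 * (√(Module.finrank 𝕜 A.range) * √(spectralSum (· ^ 2) M)) - traceNorm M) +
        μ / 2 * spectralSum (· ^ 2) M := by
  obtain ⟨u, v, huv⟩ := exists_isSingularSystem A
  set g : ℝ → ℝ := fun x => ρ x + μ / 2 * x ^ 2
  have spectralSum_g : ∀ T : E →ₗ[𝕜] E,
      spectralSum g T = spectralSum ρ T + μ / 2 * spectralSum (· ^ 2) T := fun T => by
    rw [← spectralSum_const_mul, ← spectralSum_add]
  have hsupport := spectralSum_add_cross_sub_le_sum_singularSupport A M u v hμ hL h0 hlip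
  have hcompare := huv.sum_map_add_spectralSum_normalPart_le M hconvex
    (fun x => by simp [g, he x]) (by simp [g, h0])
  have hnormal : L * traceNorm (normalPart A M) ≤ spectralSum g (normalPart A M) := by
    rw [traceNorm, ← spectralSum_const_mul]
    exact Finset.sum_le_sum fun k _ => hlow _ ((normalPart A M).singularValues_nonneg _)
  have htrace := mul_le_mul_of_nonneg_left (traceNorm_le_traceNorm_normalPart_add A M) hL
  rw [spectralSum_g (A + M), huv.spectralSum_sq_add M] at hcompare
  rw [spectralSum_g A] at hsupport
  linarith

end NormalPart

/-! ### The penalty -/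

theorem mul_le_of_convexOn_of_hasDerivWithinAt_zero {f : ℝ → ℝ} {D x : ℝ}
    (hf : ConvexOn ℝ (Set.Ici 0) f) (h0 : f 0 = 0) (hD : HasDerivWithinAt f D (Set.Ici 0) 0)
    (hx : 0 ≤ x) : D * x ≤ f x := by
  rcases hx.eq_or_lt with rfl | hx
  · simp [h0]
  have hslope := hf.le_slope_of_hasDerivWithinAt Set.self_mem_Ici (Set.mem_Ici.2 hx.le) hx hD
  rwa [slope_def_field, h0, sub_zero, sub_zero, le_div_iff₀ hx] at hslope

namespace IsPenalty

variable {ρ : ℝ → ℝ} {lam μ Cρ : ℝ}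

theorem hasDerivWithinAt_zero (h : IsPenalty ρ lam μ Cρ) :
    HasDerivWithinAt ρ (lam * Cρ) (Set.Ici 0) 0 :=
  hasDerivWithinAt_Ici_of_tendsto_deriv (s := Set.Ioi 0)
    (fun x hx => (h.differentiableAt x (ne_of_gt hx)).differentiableWithinAt)
    h.continuous.continuousWithinAt self_mem_nhdsWithin h.tendsto_deriv

theorem mul_le_add_sq (h : IsPenalty ρ lam μ Cρ) {x : ℝ} (hx : 0 ≤ x) :
    lam * Cρ * x ≤ ρ x + μ / 2 * x ^ 2 := by
  have hsq : HasDerivWithinAt (fun x : ℝ => μ / 2 * x ^ 2) 0 (Set.Ici 0) 0 := by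
    simpa using (((hasDerivAt_id (0 : ℝ)).pow 2).const_mul (μ / 2)).hasDerivWithinAt
  refine mul_le_of_convexOn_of_hasDerivWithinAt_zero
    (h.weaklyConvex.subset (Set.subset_univ _) (convex_Ici 0)) (by simp [h.map_zero]) ?_ hx
  exact (h.hasDerivWithinAt_zero.add hsq).congr_deriv (add_zero _)

theorem le_mul (h : IsPenalty ρ lam μ Cρ) {x : ℝ} (hx : 0 ≤ x) : ρ x ≤ lam * Cρ * x := by
  have hneg := mul_le_of_convexOn_of_hasDerivWithinAt_zero h.concaveOn.neg (by simp [h.map_zero])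
    h.hasDerivWithinAt_zero.neg hx
  simp only [Pi.neg_apply] at hneg
  linarith

/-- `ρ x / x` nonincreasing makes `ρ` subadditive on `[0, ∞)`: both `ρ y` and `ρ (x - y)` are at
least the corresponding fraction of `ρ x`. -/
theorem sub_le_of_le (h : IsPenalty ρ lam μ Cρ) {x y : ℝ} (hy : 0 ≤ y) (hxy : y ≤ x) :
    ρ x - ρ y ≤ lam * Cρ * (x - y) := by
  rcases hy.eq_or_lt with rfl | hy
  · simpa [h.map_zero] using h.le_mul hxy
  rcases hxy.eq_or_lt with rfl | hxy
  · simp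
  have hx := hy.trans hxy
  have hy_frac := h.antitoneOn_div (Set.mem_Ioi.2 hy) (Set.mem_Ioi.2 hx) hxy.le
  have hsub_frac := h.antitoneOn_div (Set.mem_Ioi.2 (sub_pos.2 hxy)) (Set.mem_Ioi.2 hx)
    (by linarith)
  have hlinear := h.le_mul (sub_nonneg.2 hxy.le)
  simp only at hy_frac hsub_frac
  rw [le_div_iff₀ hy] at hy_frac
  rw [le_div_iff₀ (sub_pos.2 hxy)] at hsub_frac
  have hcancel : ρ x / x * x = ρ x := div_mul_cancel₀ _ hx.ne'
  linarith

theorem map_abs (h : IsPenalty ρ lam μ Cρ) (x : ℝ) : ρ |x| = ρ x := by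
  rcases abs_choice x with hx | hx <;> rw [hx]
  exact h.even x

theorem sub_le_mul_abs (h : IsPenalty ρ lam μ Cρ) (hL : 0 ≤ lam * Cρ) (x y : ℝ) :
    ρ x - ρ y ≤ lam * Cρ * |x - y| := by
  rw [← h.map_abs x, ← h.map_abs y]
  rcases le_total |y| |x| with hxy | hxy
  · exact (h.sub_le_of_le (abs_nonneg _) hxy).trans
      (mul_le_mul_of_nonneg_left (abs_sub_abs_le_abs_sub x y) hL)
  · have hmono := h.monotoneOn (Set.mem_Ici.2 (abs_nonneg _)) (Set.mem_Ici.2 (abs_nonneg _)) hxy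
    have hnonneg := mul_nonneg hL (abs_nonneg (x - y))
    linarith

end IsPenalty

/-! ### Fourier slices -/

/-- The kernel of the unnormalised discrete Fourier transform of length `m`. -/
noncomputable def dftKernel {m : ℕ} (j k : Fin m) : ℂ :=
  Complex.exp (-(2 * (Real.pi : ℂ) * Complex.I * (j : ℕ) * (k : ℕ) / (m : ℂ)))

section Fourier

variable {m : ℕ}

theorem norm_dftKernel (j k : Fin m) : ‖dftKernel j k‖ = 1 := by
  have h : dftKernel j k = Complex.exp (((-(2 * Real.pi * j * k / m) : ℝ) : ℂ) * Complex.I) := by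
    rw [dftKernel]
    push_cast
    congr 1
    ring
  rw [h, Complex.norm_exp_ofReal_mul_I]

theorem dftKernel_eq_pow (j k : Fin m) :
    dftKernel j k = ((Complex.exp (2 * Real.pi * Complex.I / m))⁻¹ ^ (k : ℕ)) ^ (j : ℕ) := by
  rw [dftKernel, ← Complex.exp_neg, ← Complex.exp_nat_mul, ← Complex.exp_nat_mul]
  congr 1
  ring

theorem sum_conj_dftKernel_mul_dftKernel (k l : Fin m) :
    ∑ j : Fin m, (starRingEnd ℂ) (dftKernel j k) * dftKernel j l =
      if k = l then (m : ℂ) else 0 := by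
  set ζ := (Complex.exp (2 * Real.pi * Complex.I / m))⁻¹ with hζ
  have hprim : IsPrimitiveRoot ζ m := (Complex.isPrimitiveRoot_exp m k.pos.ne').inv
  have hζ0 : ζ ≠ 0 := hprim.ne_zero k.pos.ne'
  have hterm (j : Fin m) : (starRingEnd ℂ) (dftKernel j k) * dftKernel j l =
      (ζ ^ (l : ℕ) / ζ ^ (k : ℕ)) ^ (j : ℕ) := by
    rw [← Complex.inv_eq_conj (norm_dftKernel j k), dftKernel_eq_pow, dftKernel_eq_pow, ← hζ,
      div_pow, div_eq_inv_mul]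
  simp only [hterm]
  rw [Fin.sum_univ_eq_sum_range (fun j => (ζ ^ (l : ℕ) / ζ ^ (k : ℕ)) ^ j)]
  split_ifs with h
  · simp [h, div_self (pow_ne_zero _ hζ0)]
  · have hne : ζ ^ (l : ℕ) / ζ ^ (k : ℕ) ≠ 1 := by
      rw [Ne, div_eq_one_iff_eq (pow_ne_zero _ hζ0)]
      exact fun heq => h (Fin.ext (hprim.pow_inj l.2 k.2 heq).symm)
    rw [geom_sum_eq hne, div_pow, ← pow_mul, ← pow_mul, mul_comm (l : ℕ), mul_comm (k : ℕ),
      pow_mul, pow_mul, hprim.pow_eq_one]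
    simp

theorem sum_conj_dft_mul_dft (x y : Fin m → ℂ) :
    ∑ j : Fin m, (starRingEnd ℂ) (∑ k, dftKernel j k * x k) * ∑ l, dftKernel j l * y l =
      m * ∑ k, (starRingEnd ℂ) (x k) * y k := by
  simp only [map_sum, map_mul, Finset.sum_mul_sum]
  calc ∑ j : Fin m, ∑ k, ∑ l, (starRingEnd ℂ) (dftKernel j k) * (starRingEnd ℂ) (x k) *
        (dftKernel j l * y l)
      = ∑ k, ∑ l, (∑ j : Fin m, (starRingEnd ℂ) (dftKernel j k) * dftKernel j l) *
          ((starRingEnd ℂ) (x k) * y l) := by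
        rw [Finset.sum_comm]
        refine Finset.sum_congr rfl fun k _ => ?_
        rw [Finset.sum_comm]
        refine Finset.sum_congr rfl fun l _ => ?_
        rw [Finset.sum_mul]
        exact Finset.sum_congr rfl fun j _ => by ring
    _ = m * ∑ k, (starRingEnd ℂ) (x k) * y k := by
        simp only [sum_conj_dftKernel_mul_dftKernel, ite_mul, zero_mul, Finset.sum_ite_eq,
          Finset.mem_univ, if_true, Finset.mul_sum]

end Fourier

namespace Tensor

variable {d d₃ : ℕ}

/-- The `j`-th Fourier slice as an operator on `ℂ^d`. -/
noncomputable def sliceMap (T : Tensor d d₃) (j : Fin d₃) :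
    EuclideanSpace ℂ (Fin d) →ₗ[ℂ] EuclideanSpace ℂ (Fin d) :=
  Matrix.toEuclideanLin (T.fourierSlice j)

theorem fourierSlice_apply (T : Tensor d d₃) (j : Fin d₃) (a b : Fin d) :
    T.fourierSlice j a b = ∑ k, dftKernel j k * ((T (a, b, k) : ℝ) : ℂ) := rfl

theorem fourierSlice_add (S T : Tensor d d₃) (j : Fin d₃) :
    (S + T).fourierSlice j = S.fourierSlice j + T.fourierSlice j := by
  ext a b
  simp [fourierSlice_apply, mul_add, Finset.sum_add_distrib]

theorem fourierSlice_smul (c : ℝ) (T : Tensor d d₃) (j : Fin d₃) :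
    (c • T).fourierSlice j = (c : ℂ) • T.fourierSlice j := by
  ext a b
  simp [fourierSlice_apply, Finset.mul_sum, mul_left_comm]

theorem sliceMap_add (S T : Tensor d d₃) (j : Fin d₃) :
    (S + T).sliceMap j = S.sliceMap j + T.sliceMap j := by
  rw [sliceMap, fourierSlice_add, map_add]; rfl

theorem sliceMap_smul (c : ℝ) (T : Tensor d d₃) (j : Fin d₃) :
    (c • T).sliceMap j = (c : ℂ) • T.sliceMap j := by
  rw [sliceMap, fourierSlice_smul, map_smul]; rfl

theorem sliceMap_apply (T : Tensor d d₃) (j : Fin d₃) (v : EuclideanSpace ℂ (Fin d)) (a : Fin d) :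
    T.sliceMap j v a = ∑ b, T.fourierSlice j a b * v b := by
  simp [sliceMap, Matrix.toEuclideanLin, Matrix.toLpLin_apply, Matrix.mulVec, dotProduct]

theorem inner_sliceMap_basisFun (S T : Tensor d d₃) (j : Fin d₃) (b : Fin d) :
    inner ℂ (S.sliceMap j (EuclideanSpace.basisFun (Fin d) ℂ b))
      (T.sliceMap j (EuclideanSpace.basisFun (Fin d) ℂ b)) =
      ∑ a, (starRingEnd ℂ) (S.fourierSlice j a b) * T.fourierSlice j a b := by
  simp [PiLp.inner_apply, sliceMap_apply, mul_comm]

theorem sum_conj_fourierSlice_mul_fourierSlice (S T : Tensor d d₃) (a b : Fin d) :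
    ∑ j, (starRingEnd ℂ) (S.fourierSlice j a b) * T.fourierSlice j a b =
      ((d₃ * ∑ k, S (a, b, k) * T (a, b, k) : ℝ) : ℂ) := by
  simp only [fourierSlice_apply, sum_conj_dft_mul_dft, Complex.conj_ofReal]
  push_cast
  rfl

theorem inner_eq_sum_inner_sliceMap (S T : Tensor d d₃) :
    ⟪S, T⟫ = (1 / (d₃ : ℝ)) * ∑ j, ∑ b,
      (inner ℂ (S.sliceMap j (EuclideanSpace.basisFun (Fin d) ℂ b))
        (T.sliceMap j (EuclideanSpace.basisFun (Fin d) ℂ b))).re := by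
  rcases d₃.eq_zero_or_pos with rfl | hd₃
  · simp [PiLp.inner_apply]
  have hsum : ∑ j, ∑ b, (inner ℂ (S.sliceMap j (EuclideanSpace.basisFun (Fin d) ℂ b))
        (T.sliceMap j (EuclideanSpace.basisFun (Fin d) ℂ b))).re =
      ∑ a, ∑ b, (d₃ * ∑ k, S (a, b, k) * T (a, b, k) : ℝ) := by
    simp only [inner_sliceMap_basisFun, Complex.re_sum]
    rw [Finset.sum_comm]
    conv_lhs => enter [2, b]; rw [Finset.sum_comm]
    rw [Finset.sum_comm]
    refine Finset.sum_congr rfl fun a _ => Finset.sum_congr rfl fun b _ => ?_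
    rw [← Complex.re_sum, sum_conj_fourierSlice_mul_fourierSlice, Complex.ofReal_re]
  have h0 : (d₃ : ℝ) ≠ 0 := by positivity
  rw [hsum, PiLp.inner_apply]
  simp only [Fintype.sum_prod_type, ← Finset.mul_sum]
  rw [← mul_assoc, one_div_mul_cancel h0, one_mul]
  simp [mul_comm]

/-! ### Spectral regularizers -/

theorem regularizer_eq_sum_spectralSum (ρ : ℝ → ℝ) (T : Tensor d d₃) :
    T.regularizer ρ = (1 / (d₃ : ℝ)) * ∑ j, spectralSum ρ (T.sliceMap j) := by
  rw [regularizer, Finset.sum_comm]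
  congr 1
  exact Finset.sum_congr rfl fun j _ => (spectralSum_eq_sum (by simp) ρ (T.sliceMap j)).symm

theorem nuclearNorm_eq_sum_traceNorm (T : Tensor d d₃) :
    T.nuclearNorm = (1 / (d₃ : ℝ)) * ∑ j, traceNorm (T.sliceMap j) :=
  T.regularizer_eq_sum_spectralSum fun s => s

theorem norm_sq_eq_sum_spectralSum_sq (T : Tensor d d₃) :
    ‖T‖ ^ 2 = (1 / (d₃ : ℝ)) * ∑ j, spectralSum (· ^ 2) (T.sliceMap j) := by
  rw [← real_inner_self_eq_norm_sq, inner_eq_sum_inner_sliceMap]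
  congr 1
  refine Finset.sum_congr rfl fun j _ => ?_
  rw [← sum_sq_norm_apply_eq_spectralSum (T.sliceMap j) (EuclideanSpace.basisFun (Fin d) ℂ)]
  exact Finset.sum_congr rfl fun b _ => inner_self_eq_norm_sq (𝕜 := ℂ) _

theorem nuclearNorm_nonneg (T : Tensor d d₃) : 0 ≤ T.nuclearNorm :=
  mul_nonneg (by positivity) (Finset.sum_nonneg fun _ _ => Finset.sum_nonneg fun i _ =>
    LinearMap.singularValues_nonneg _ _)

theorem norm_le_sqrt_mul_nuclearNorm (T : Tensor d d₃) :
    ‖T‖ ≤ √(d₃ : ℝ) * T.nuclearNorm := by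
  rcases d₃.eq_zero_or_pos with rfl | hd₃
  · simp [Subsingleton.elim T 0]
  have hnonneg (i : Fin d) (j : Fin d₃) : 0 ≤ T.sv i j := LinearMap.singularValues_nonneg _ _
  have hsum : ∑ i, ∑ j, T.sv i j ^ 2 ≤ (∑ i, ∑ j, T.sv i j) ^ 2 :=
    (Finset.sum_le_sum fun i _ => Finset.sum_sq_le_sq_sum_of_nonneg fun j _ => hnonneg i j).trans
      (Finset.sum_sq_le_sq_sum_of_nonneg fun i _ => Finset.sum_nonneg fun j _ => hnonneg i j)
  refine le_of_sq_le_sq ?_ (mul_nonneg (Real.sqrt_nonneg _) T.nuclearNorm_nonneg)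
  calc ‖T‖ ^ 2 = 1 / (d₃ : ℝ) * ∑ i, ∑ j, T.sv i j ^ 2 := by
        rw [norm_sq_eq_sum_spectralSum_sq, ← regularizer_eq_sum_spectralSum, regularizer]
    _ ≤ 1 / (d₃ : ℝ) * (∑ i, ∑ j, T.sv i j) ^ 2 := by gcongr
    _ = (√(d₃ : ℝ) * T.nuclearNorm) ^ 2 := by
        rw [mul_pow, Real.sq_sqrt (Nat.cast_nonneg _), nuclearNorm]
        field_simp

theorem convexOn_regularizer {f : ℝ → ℝ} (hf : ConvexOn ℝ Set.univ f) (he : Function.Even f)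
    (h0 : f 0 = 0) : ConvexOn ℝ Set.univ (regularizer f : Tensor d d₃ → ℝ) := by
  refine ⟨convex_univ, fun S _ T _ s t hs ht hst => ?_⟩
  simp only [regularizer_eq_sum_spectralSum, sliceMap_add, sliceMap_smul, smul_eq_mul]
  rw [mul_left_comm, mul_left_comm t, ← mul_add, Finset.mul_sum _ _ s, Finset.mul_sum _ _ t,
    ← Finset.sum_add_distrib]
  gcongr with j
  exact convexOn_spectralSum hf he h0 _ _ hs ht hst

theorem regularizer_add_sq (ρ : ℝ → ℝ) (c : ℝ) (T : Tensor d d₃) :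
    T.regularizer (fun x => ρ x + c * x ^ 2) = T.regularizer ρ + c * ‖T‖ ^ 2 := by
  simp only [regularizer_eq_sum_spectralSum, norm_sq_eq_sum_spectralSum_sq, spectralSum_add,
    spectralSum_const_mul, Finset.sum_add_distrib, ← Finset.mul_sum]
  ring

theorem finrank_range_sliceMap_le_tubalRank (T : Tensor d d₃) (j : Fin d₃) :
    Module.finrank ℂ (T.sliceMap j).range ≤ T.tubalRank := by
  have hd : Module.finrank ℂ (EuclideanSpace ℂ (Fin d)) = d := by simp
  rw [← card_singularSupport, ← Finset.card_map (finCongr hd).toEmbedding, ← Set.ncard_coe_finset,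
    tubalRank]
  refine Set.ncard_le_ncard (fun i hi => ⟨j, ?_⟩) (Set.toFinite _)
  obtain ⟨k, hk, rfl⟩ := Finset.mem_map.1 (Finset.mem_coe.1 hi)
  exact mem_singularSupport.1 hk

theorem sum_sqrt_spectralSum_sq_le (T : Tensor d d₃) :
    ∑ j, √(spectralSum (· ^ 2) (T.sliceMap j)) ≤ d₃ * ‖T‖ := by
  rcases d₃.eq_zero_or_pos with rfl | hd₃
  · simp
  have hnonneg (j : Fin d₃) : 0 ≤ spectralSum (· ^ 2) (T.sliceMap j) :=
    Finset.sum_nonneg fun _ _ => sq_nonneg _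
  have h := sum_le_sqrt_card_mul_sqrt_sum_sq Finset.univ
    fun j => √(spectralSum (· ^ 2) (T.sliceMap j))
  have hsq : ∑ j, spectralSum (· ^ 2) (T.sliceMap j) = d₃ * ‖T‖ ^ 2 := by
    rw [norm_sq_eq_sum_spectralSum_sq]
    field_simp
  simp only [Real.sq_sqrt (hnonneg _), hsq, Finset.card_univ, Fintype.card_fin] at h
  rwa [Real.sqrt_mul (Nat.cast_nonneg _), Real.sqrt_sq (norm_nonneg _), ← mul_assoc,
    Real.mul_self_sqrt (Nat.cast_nonneg _)] at h

theorem regularizer_sub_regularizer_add_le {ρ : ℝ → ℝ} {lam μ Cρ : ℝ} (hρ : IsPenalty ρ lam μ Cρ)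
    (hL : 0 ≤ lam * Cρ) (S T : Tensor d d₃) :
    S.regularizer ρ - (S + T).regularizer ρ ≤
      lam * Cρ * (3 * (√(S.tubalRank : ℝ) * ‖T‖) - T.nuclearNorm) + μ / 2 * ‖T‖ ^ 2 := by
  have hslice (j : Fin d₃) : spectralSum ρ (S.sliceMap j) - spectralSum ρ ((S + T).sliceMap j) ≤
      lam * Cρ * (3 * (√(S.tubalRank : ℝ) * √(spectralSum (· ^ 2) (T.sliceMap j))) -
        traceNorm (T.sliceMap j)) + μ / 2 * spectralSum (· ^ 2) (T.sliceMap j) := by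
    rw [sliceMap_add]
    refine (spectralSum_sub_spectralSum_add_le hρ.mu_pos.le hL hρ.weaklyConvex hρ.even hρ.map_zero
      (hρ.sub_le_mul_abs hL) (fun _ hx => hρ.mul_le_add_sq hx) _ _).trans ?_
    gcongr
    exact S.finrank_range_sliceMap_le_tubalRank j
  have hsum := Finset.sum_le_sum fun j (_ : j ∈ Finset.univ) => hslice j
  simp only [Finset.sum_sub_distrib, Finset.sum_add_distrib, ← Finset.mul_sum] at hsum
  have hcross : (1 / (d₃ : ℝ)) * ∑ j, √(spectralSum (· ^ 2) (T.sliceMap j)) ≤ ‖T‖ := by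
    rcases d₃.eq_zero_or_pos with rfl | hd₃
    · simp
    rw [one_div, inv_mul_le_iff₀ (by positivity)]
    exact T.sum_sqrt_spectralSum_sq_le
  calc S.regularizer ρ - (S + T).regularizer ρ
      = 1 / (d₃ : ℝ) * (∑ j, spectralSum ρ (S.sliceMap j) -
          ∑ j, spectralSum ρ ((S + T).sliceMap j)) := by
        rw [regularizer_eq_sum_spectralSum, regularizer_eq_sum_spectralSum, mul_sub]
    _ ≤ 1 / (d₃ : ℝ) * _ := mul_le_mul_of_nonneg_left hsum (by positivity)
    _ = lam * Cρ * (3 * (√(S.tubalRank : ℝ) * ((1 / (d₃ : ℝ)) *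
          ∑ j, √(spectralSum (· ^ 2) (T.sliceMap j)))) - T.nuclearNorm) + μ / 2 * ‖T‖ ^ 2 := by
        rw [nuclearNorm_eq_sum_traceNorm, norm_sq_eq_sum_spectralSum_sq]
        ring
    _ ≤ lam * Cρ * (3 * (√(S.tubalRank : ℝ) * ‖T‖) - T.nuclearNorm) + μ / 2 * ‖T‖ ^ 2 := by
        gcongr

end Tensor

/-! ### Atoms of the nuclear norm -/

section HalfNet

theorem card_le_of_half_separated {F : Type*} [NormedAddCommGroup F] [NormedSpace ℝ F]
    [FiniteDimensional ℝ F] {t : Finset F} (ht : ∀ x ∈ t, ‖x‖ ≤ 1)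
    (hsep : ∀ x ∈ t, ∀ y ∈ t, x ≠ y → 1 / 2 ≤ ‖x - y‖) : t.card ≤ 5 ^ Module.finrank ℝ F := by
  classical
  have hnorm (x : F) : ‖(2 : ℝ) • x‖ = 2 * ‖x‖ := by rw [norm_smul, Real.norm_two]
  rw [← Finset.card_image_of_injective t (smul_right_injective F (two_ne_zero (α := ℝ)))]
  refine Besicovitch.card_le_of_separated _ ?_ ?_ <;>
    simp only [Finset.forall_mem_image, ← smul_sub, hnorm]
  · exact fun x hx => by linarith [ht x hx]
  · exact fun x hx y hy hxy => by linarith [hsep x hx y hy fun h => hxy (h ▸ rfl)]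

theorem packingNumber_closedBall_le (F : Type*) [NormedAddCommGroup F] [NormedSpace ℝ F]
    [FiniteDimensional ℝ F] :
    Metric.packingNumber (1 / 2) (Metric.closedBall (0 : F) 1) ≤ (5 ^ Module.finrank ℝ F : ℕ) := by
  refine iSup_le fun C => iSup_le fun hC => iSup_le fun hsep => ?_
  by_contra! hlt
  obtain ⟨t, htC, ht⟩ := Set.exists_subset_encard_eq (Order.add_one_le_of_lt hlt)
  lift t to Finset F using Set.finite_of_encard_eq_coe (by exact_mod_cast ht)
  have hle : t.card ≤ 5 ^ Module.finrank ℝ F := by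
    refine card_le_of_half_separated (fun x hx => mem_closedBall_zero_iff.1 (hC (htC hx)))
      fun x hx y hy hxy => ?_
    have h : ((1 / 2 : ℝ≥0) : ℝ≥0∞) < edist x y := hsep (htC hx) (htC hy) hxy
    rw [edist_dist, ENNReal.lt_ofReal_iff_toReal_lt (by simp), dist_eq_norm] at h
    simpa using h.le
  rw [Set.encard_coe_eq_coe_finsetCard] at ht
  norm_cast at ht
  omega

theorem exists_isCover_closedBall (F : Type*) [NormedAddCommGroup F] [NormedSpace ℝ F]
    [FiniteDimensional ℝ F] : ∃ s : Finset F, s.card ≤ 5 ^ Module.finrank ℝ F ∧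
      (∀ x ∈ s, ‖x‖ ≤ 1) ∧ Metric.IsCover (1 / 2) (Metric.closedBall (0 : F) 1) (s : Set F) := by
  have hle := (Metric.coveringNumber_le_packingNumber _ _).trans (packingNumber_closedBall_le F)
  obtain ⟨s, hs, hfin, hcover, hcard⟩ := Metric.exists_set_encard_eq_coveringNumber
    (ne_top_of_le_ne_top (ENat.natCast_ne_top _) hle)
  lift s to Finset F using hfin
  refine ⟨s, ?_, fun x hx => mem_closedBall_zero_iff.1 (hs hx), hcover⟩
  rw [← hcard, Set.encard_coe_eq_coe_finsetCard] at hle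
  exact_mod_cast hle

variable {𝕜 E : Type*} [RCLike 𝕜] [NormedAddCommGroup E] [InnerProductSpace 𝕜 E] {s : Set E}

theorem norm_le_two_mul_of_isCover (hs : Metric.IsCover (1 / 2) (Metric.closedBall (0 : E) 1) s)
    (w : E) {c : ℝ} (hw : ∀ y ∈ s, RCLike.re (inner 𝕜 y w) ≤ c) : ‖w‖ ≤ 2 * c := by
  set x : E := ((‖w‖⁻¹ : ℝ) : 𝕜) • w with hx
  have hxw : RCLike.re (inner 𝕜 x w) = ‖w‖ := by
    rw [hx, inner_smul_left, RCLike.conj_ofReal, RCLike.re_ofReal_mul, inner_self_eq_norm_mul_norm,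
      ← mul_assoc]
    rcases eq_or_ne ‖w‖ 0 with h | h <;> simp [h]
  have hx1 : ‖x‖ ≤ 1 := by
    rw [hx, norm_smul, RCLike.norm_ofReal, abs_inv, abs_norm]
    exact inv_mul_le_one
  obtain ⟨y, hy, hxy⟩ := hs (mem_closedBall_zero_iff.2 hx1)
  have hdist : ‖x - y‖ ≤ 1 / 2 := by
    rw [← dist_eq_norm]
    exact edist_le_coe.1 hxy
  have hsub : RCLike.re (inner 𝕜 (x - y) w) ≤ 1 / 2 * ‖w‖ :=
    (re_inner_le_norm _ _).trans (by gcongr)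
  rw [inner_sub_left, map_sub, hxw] at hsub
  linarith [hw y hy]

theorem re_inner_apply_le_four_mul_of_isCover [FiniteDimensional 𝕜 E]
    (hs : Metric.IsCover (1 / 2) (Metric.closedBall (0 : E) 1) s) {T : E →ₗ[𝕜] E} {c : ℝ}
    (hT : ∀ a ∈ s, ∀ b ∈ s, RCLike.re (inner 𝕜 a (T b)) ≤ c) {u v : E} (hu : ‖u‖ = 1)
    (hv : ‖v‖ = 1) : RCLike.re (inner 𝕜 u (T v)) ≤ 4 * c := by
  have hadj (a : E) (ha : a ∈ s) : ‖LinearMap.adjoint T a‖ ≤ 2 * c := by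
    refine norm_le_two_mul_of_isCover (𝕜 := 𝕜) hs _ fun b hb => ?_
    rw [LinearMap.adjoint_inner_right, inner_re_symm]
    exact hT a ha b hb
  have hTv : ‖T v‖ ≤ 2 * (2 * c) := by
    refine norm_le_two_mul_of_isCover (𝕜 := 𝕜) hs _ fun a ha => ?_
    rw [← LinearMap.adjoint_inner_left]
    exact (re_inner_le_norm _ _).trans (by rw [hv, mul_one]; exact hadj a ha)
  exact (re_inner_le_norm _ _).trans (by rw [hu, one_mul]; linarith)

end HalfNet

namespace Tensor

variable {d d₃ : ℕ}

/-- The tensor representing the real functional `M ↦ Re ⟪u, M_j v⟫`, where `M_j` is the `j`-th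
Fourier slice of `M`. For unit vectors `u`, `v` these tensors play the part of the rank-one
matrices in the duality between the nuclear and the operator norm. -/
noncomputable def atom (u v : EuclideanSpace ℂ (Fin d)) (j : Fin d₃) : Tensor d d₃ :=
  WithLp.toLp 2 fun p => ((starRingEnd ℂ) (u p.1) * (dftKernel j p.2.2 * v p.2.1)).re

theorem inner_atom (M : Tensor d d₃) (u v : EuclideanSpace ℂ (Fin d)) (j : Fin d₃) :
    ⟪M, atom u v j⟫ = (inner ℂ u (M.sliceMap j v)).re := by
  simp only [PiLp.inner_apply, sliceMap_apply, fourierSlice_apply, Fintype.sum_prod_type,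
    Finset.sum_mul, RCLike.inner_apply, Complex.re_sum]
  refine Finset.sum_congr rfl fun a _ => Finset.sum_congr rfl fun b _ =>
    Finset.sum_congr rfl fun k _ => ?_
  rw [atom, conj_trivial, ← Complex.re_mul_ofReal]
  congr 1
  ring

theorem norm_atom_sq_le {u v : EuclideanSpace ℂ (Fin d)} (j : Fin d₃) (hu : ‖u‖ ≤ 1)
    (hv : ‖v‖ ≤ 1) : ‖atom u v j‖ ^ 2 ≤ d₃ := by
  have hentry (a b : Fin d) (k : Fin d₃) :
      ‖atom u v j (a, b, k)‖ ^ 2 ≤ ‖u a‖ ^ 2 * ‖v b‖ ^ 2 := by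
    rw [← mul_pow]
    refine pow_le_pow_left₀ (norm_nonneg _) ((Complex.abs_re_le_norm _).trans_eq ?_) 2
    rw [norm_mul, norm_mul, norm_dftKernel, one_mul, RCLike.norm_conj]
  calc ‖atom u v j‖ ^ 2 ≤ ∑ a, ∑ b, ∑ _k : Fin d₃, ‖u a‖ ^ 2 * ‖v b‖ ^ 2 := by
        rw [EuclideanSpace.norm_sq_eq]
        simp only [Fintype.sum_prod_type]
        gcongr
        exact hentry _ _ _
    _ = d₃ * (‖u‖ * ‖v‖) ^ 2 := by
        simp only [Finset.sum_const, Finset.card_univ, Fintype.card_fin, nsmul_eq_mul,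
          ← Finset.mul_sum, ← Finset.sum_mul, ← EuclideanSpace.norm_sq_eq, mul_pow]
    _ ≤ d₃ * 1 ^ 2 := by
        gcongr
        exact mul_le_one₀ hu (norm_nonneg _) hv
    _ = d₃ := by ring

theorem inner_le_mul_nuclearNorm {M : Tensor d d₃} {c : ℝ}
    (hM : ∀ (j : Fin d₃) (u v : EuclideanSpace ℂ (Fin d)), ‖u‖ = 1 → ‖v‖ = 1 →
      (inner ℂ u (M.sliceMap j v)).re ≤ c) (T : Tensor d d₃) : ⟪M, T⟫ ≤ c * T.nuclearNorm := by
  rw [inner_eq_sum_inner_sliceMap, nuclearNorm_eq_sum_traceNorm, mul_left_comm,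
    Finset.mul_sum _ _ c]
  gcongr with j
  exact sum_re_inner_apply_le_mul_traceNorm (𝕜 := ℂ) (hM j) _ _

/-- A finite family of tensors whose convex hull contains a quarter of the unit ball of the nuclear
norm; this inclusion is encoded in its dual form `inner_le`. -/
structure IsAtomNet (N : Finset (Tensor d d₃)) : Prop where
  card_le : N.card ≤ d₃ * 625 ^ d
  norm_sq_le : ∀ a ∈ N, ‖a‖ ^ 2 ≤ d₃
  inner_le : ∀ (M T : Tensor d d₃) (c : ℝ), (∀ a ∈ N, ⟪M, a⟫ ≤ c) → ⟪M, T⟫ ≤ 4 * c * T.nuclearNorm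

theorem exists_isAtomNet (d d₃ : ℕ) : ∃ N : Finset (Tensor d d₃), IsAtomNet N := by
  classical
  obtain ⟨s, hcard, hnorm, hcover⟩ := exists_isCover_closedBall (EuclideanSpace ℂ (Fin d))
  refine ⟨(Finset.univ ×ˢ s ×ˢ s).image fun p => atom p.2.1 p.2.2 p.1, ?_, ?_, ?_⟩
  · rw [finrank_real_of_complex, finrank_euclideanSpace_fin] at hcard
    calc _ ≤ (Finset.univ ×ˢ s ×ˢ s : Finset (Fin d₃ × _ × _)).card := Finset.card_image_le
      _ = d₃ * (s.card * s.card) := by simp only [Finset.card_product, Finset.card_fin]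
      _ ≤ d₃ * (5 ^ (2 * d) * 5 ^ (2 * d)) := by gcongr
      _ = d₃ * 625 ^ d := by rw [← pow_add, ← two_mul, ← mul_assoc, pow_mul]; norm_num
  · simp only [Finset.forall_mem_image, Finset.mem_product]
    exact fun p hp => norm_atom_sq_le _ (hnorm _ hp.2.1) (hnorm _ hp.2.2)
  · intro M T c hM
    refine inner_le_mul_nuclearNorm (fun j u v hu hv => ?_) T
    refine re_inner_apply_le_four_mul_of_isCover (𝕜 := ℂ) hcover (fun a ha b hb => ?_) hu hv
    exact (inner_atom M a b j).symm.trans_le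
      (hM _ (Finset.mem_image.2 ⟨(j, a, b), by simpa using ⟨ha, hb⟩, rfl⟩))

theorem IsAtomNet.exists_mem_convexHull {N : Finset (Tensor d d₃)} (hN : IsAtomNet N)
    {T : Tensor d d₃} (hT : T ≠ 0) :
    ∃ x ∈ convexHull ℝ (N : Set (Tensor d d₃)), T = (4 * T.nuclearNorm) • x := by
  have hpos : 0 < T.nuclearNorm :=
    pos_of_mul_pos_right ((norm_pos_iff.2 hT).trans_le T.norm_le_sqrt_mul_nuclearNorm)
      (Real.sqrt_nonneg _)
  refine ⟨(4 * T.nuclearNorm)⁻¹ • T, ?_, (smul_inv_smul₀ (by positivity) T).symm⟩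
  by_contra hmem
  obtain ⟨f, c, hlt, hgt⟩ := geometric_hahn_banach_closed_point (convex_convexHull ℝ _)
    (N.finite_toSet.isClosed_convexHull (𝕜 := ℝ)) hmem
  set M := (InnerProductSpace.toDual ℝ (Tensor d d₃)).symm f
  have hf (x : Tensor d d₃) : f x = ⟪M, x⟫ := InnerProductSpace.toDual_symm_apply.symm
  have hle := hN.inner_le M T c fun a ha =>
    (hf a).symm.trans_le (hlt a (subset_convexHull ℝ _ ha)).le
  rw [map_smul, smul_eq_mul, hf, ← div_eq_inv_mul, lt_div_iff₀ (by positivity)] at hgt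
  linarith

end Tensor

/-! ### Stationary points -/

section StationaryPoint

variable {E : Type*} [NormedAddCommGroup E] [InnerProductSpace ℝ E]

theorem IsStationaryPoint.nonneg_of_le_quadratic {F : E → ℝ} {x : E} (hx : IsStationaryPoint F x)
    {z : E} {D C : ℝ}
    (hF : ∀ t ∈ Set.Ioo (0 : ℝ) 1, F ((1 - t) • x + t • z) ≤ F x + t * D + t ^ 2 * C) :
    0 ≤ D := by
  have hpath : Tendsto (fun t : ℝ => (1 - t) • x + t • z) (𝓝[>] 0) (𝓝 x) := by
    have : Continuous fun t : ℝ => (1 - t) • x + t • z := by fun_prop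
    simpa using (this.tendsto 0).mono_left nhdsWithin_le_nhds
  have hslope : Tendsto (fun t : ℝ => D + t * C) (𝓝[>] 0) (𝓝 D) := by
    have : Continuous fun t : ℝ => D + t * C := by fun_prop
    simpa using (this.tendsto 0).mono_left nhdsWithin_le_nhds
  have hD : ∀ η : ℝ, 0 < η → -(η * ‖z - x‖) ≤ D := by
    refine fun η hη => ge_of_tendsto hslope ?_
    filter_upwards [hpath.eventually (hx η hη), Ioo_mem_nhdsGT one_pos] with t hsub ht
    have hstep : (1 - t) • x + t • z - x = t • (z - x) := by module
    rw [inner_zero_left, hstep, norm_smul, Real.norm_of_nonneg ht.1.le] at hsub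
    refine le_of_mul_le_mul_left ?_ ht.1
    linarith [hF t ht]
  have hzero : Tendsto (fun η : ℝ => -(η * ‖z - x‖)) (𝓝[>] 0) (𝓝 0) := by
    have : Continuous fun η : ℝ => -(η * ‖z - x‖) := by fun_prop
    simpa using (this.tendsto 0).mono_left nhdsWithin_le_nhds
  exact le_of_tendsto hzero (eventually_nhdsWithin_of_forall hD)

end StationaryPoint

section MeanSquare

variable {E : Type*} [NormedAddCommGroup E] [InnerProductSpace ℝ E] {n : ℕ}

/-- The empirical second moment `(1 / n) ∑ ⟪x_i, v⟫²` of a design `x` in the direction `v`. -/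
noncomputable def meanSquare (x : Fin n → E) (v : E) : ℝ :=
  (1 / (n : ℝ)) * ∑ i, ⟪x i, v⟫ ^ 2

theorem meanSquare_nonneg (x : Fin n → E) (v : E) : 0 ≤ meanSquare x v := by
  unfold meanSquare
  positivity

end MeanSquare

section Deterministic

variable {d d₃ n : ℕ} {ρ : ℝ → ℝ} {lam μ Cρ : ℝ}

theorem empiricalRisk_segment {x : Fin n → Tensor d d₃} {y ε : Fin n → ℝ} {B₀ : Tensor d d₃}
    (hy : ∀ i, y i = ⟪x i, B₀⟫ + ε i) (B : Tensor d d₃) (t : ℝ) :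
    empiricalRisk x y ((1 - t) • B + t • B₀) = empiricalRisk x y B +
      t * (⟪(1 / (n : ℝ)) • ∑ i, ε i • x i, B - B₀⟫ - meanSquare x (B - B₀)) +
      t ^ 2 * (meanSquare x (B - B₀) / 2) := by
  have hres : ∀ i, (y i - ⟪x i, (1 - t) • B + t • B₀⟫) ^ 2 = (y i - ⟪x i, B⟫) ^ 2 +
      2 * t * (ε i * ⟪x i, B - B₀⟫ - ⟪x i, B - B₀⟫ ^ 2) + t ^ 2 * ⟪x i, B - B₀⟫ ^ 2 := by
    intro i
    rw [hy, inner_add_right, real_inner_smul_right, real_inner_smul_right, inner_sub_right]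
    ring
  simp only [empiricalRisk, meanSquare, real_inner_smul_left, sum_inner, hres,
    Finset.sum_add_distrib, ← Finset.mul_sum, Finset.sum_sub_distrib]
  ring

theorem Tensor.strongConvexOn_regularizer (hρ : IsPenalty ρ lam μ Cρ) :
    StrongConvexOn Set.univ (-μ) (regularizer ρ : Tensor d d₃ → ℝ) := by
  rw [strongConvexOn_iff_convex]
  have heven : Function.Even fun x => ρ x + μ / 2 * x ^ 2 := fun x => by
    simp only [hρ.even, neg_sq]
  refine (convexOn_regularizer hρ.weaklyConvex heven (by simp [hρ.map_zero])).congr fun T _ => ?_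
  rw [regularizer_add_sq]
  ring

theorem IsStationaryPoint.meanSquare_le (hρ : IsPenalty ρ lam μ Cρ)
    {x : Fin n → Tensor d d₃} {y ε : Fin n → ℝ} {B₀ B : Tensor d d₃}
    (hy : ∀ i, y i = ⟪x i, B₀⟫ + ε i) (hB : IsStationaryPoint (objective x y ρ) B) :
    meanSquare x (B - B₀) ≤ ⟪(1 / (n : ℝ)) • ∑ i, ε i • x i, B - B₀⟫ +
      (B₀.regularizer ρ - B.regularizer ρ) + μ / 2 * ‖B - B₀‖ ^ 2 := by
  have hslope := hB.nonneg_of_le_quadratic (z := B₀)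
    (D := ⟪(1 / (n : ℝ)) • ∑ i, ε i • x i, B - B₀⟫ - meanSquare x (B - B₀) +
      (B₀.regularizer ρ - B.regularizer ρ) + μ / 2 * ‖B - B₀‖ ^ 2)
    (C := meanSquare x (B - B₀) / 2 - μ / 2 * ‖B - B₀‖ ^ 2) fun t ht => by
      have hreg := (Tensor.strongConvexOn_regularizer hρ).2 (Set.mem_univ B) (Set.mem_univ B₀)
        (sub_nonneg.2 ht.2.le) ht.1.le (sub_add_cancel 1 t)
      simp only [smul_eq_mul] at hreg
      rw [objective, objective, empiricalRisk_segment hy]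
      linarith
  linarith

/-- Solves the inequalities satisfied by the Frobenius error `a`, the nuclear error `s` and the
prediction error `Q` at a stationary point, where `w ^ 2` is the rank. -/
theorem error_bounds_of_basic_inequality {a s Q L w D μ : ℝ} (ha0 : 0 ≤ a) (hs0 : 0 ≤ s)
    (hL : 0 < L) (hw : 0 ≤ w) (hD : 0 < D) (hμ : 0 ≤ μ)
    (hupper : Q ≤ 3 * L * w * a - 3 / 4 * (L * s) + μ * a ^ 2)
    (hlower : (D + 3 * μ) / 3 * a ^ 2 - L * s / 4 ≤ Q) :
    a ≤ 9 * (L * w) / D ∧ s ≤ 54 * (L * w ^ 2) / D ∧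
      Q ≤ L ^ 2 * w ^ 2 * (27 / D + 81 * μ / D ^ 2) := by
  have hLs : 0 ≤ L * s := by positivity
  have hcurv : D / 3 * a ^ 2 ≤ L * (3 * (w * a) - s / 2) := by linarith
  have hcone : s ≤ 6 * (w * a) := by
    have : 0 ≤ L * (3 * (w * a) - s / 2) := le_trans (by positivity) hcurv
    linarith [nonneg_of_mul_nonneg_right this hL]
  have ha : a ≤ 9 * (L * w) / D := by
    rw [le_div_iff₀ hD]
    rcases ha0.eq_or_lt with rfl | hpos
    · rw [zero_mul]
      positivity
    · refine le_of_mul_le_mul_left ?_ hpos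
      linarith
  refine ⟨ha, ?_, ?_⟩
  · calc s ≤ 6 * (w * a) := hcone
      _ ≤ 6 * (w * (9 * (L * w) / D)) := by gcongr
      _ = 54 * (L * w ^ 2) / D := by ring
  · calc Q ≤ 3 * L * w * a + μ * a ^ 2 := by linarith
      _ ≤ 3 * L * w * (9 * (L * w) / D) + μ * (9 * (L * w) / D) ^ 2 := by gcongr
      _ = L ^ 2 * w ^ 2 * (27 / D + 81 * μ / D ^ 2) := by
        field_simp
        ring

theorem IsStationaryPoint.error_bounds (hρ : IsPenalty ρ lam μ Cρ)
    (hL : 0 < lam * Cρ) {x : Fin n → Tensor d d₃} {y ε : Fin n → ℝ} {B₀ B : Tensor d d₃}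
    (hy : ∀ i, y i = ⟪x i, B₀⟫ + ε i) (hB : IsStationaryPoint (objective x y ρ) B) {r : ℕ}
    (hr : B₀.tubalRank ≤ r) {Λ : ℝ} (hΛ : 3 * μ < 2 * Λ)
    (hnoise : ⟪(1 / (n : ℝ)) • ∑ i, ε i • x i, B - B₀⟫ ≤ lam * Cρ / 4 * (B - B₀).nuclearNorm)
    (hrsc : 2 / 3 * Λ * ‖B - B₀‖ ^ 2 - lam * Cρ / 4 * (B - B₀).nuclearNorm ≤
      meanSquare x (B - B₀)) :
    ‖B - B₀‖ ≤ 9 * (lam * Cρ * √r) / (2 * Λ - 3 * μ) ∧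
      (B - B₀).nuclearNorm ≤ 54 * (lam * Cρ * √r ^ 2) / (2 * Λ - 3 * μ) ∧
      meanSquare x (B - B₀) ≤ (lam * Cρ) ^ 2 * √r ^ 2 *
        (27 / (2 * Λ - 3 * μ) + 81 * μ / (2 * Λ - 3 * μ) ^ 2) := by
  have hreg := Tensor.regularizer_sub_regularizer_add_le hρ hL.le B₀ (B - B₀)
  rw [add_sub_cancel] at hreg
  have hrank : lam * Cρ * (√B₀.tubalRank * ‖B - B₀‖) ≤ lam * Cρ * (√r * ‖B - B₀‖) := by gcongr
  refine error_bounds_of_basic_inequality (norm_nonneg _) (B - B₀).nuclearNorm_nonneg hL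
    (Real.sqrt_nonneg _) (by linarith) hρ.mu_pos.le ?_ ?_
  · linarith [hB.meanSquare_le hρ hy]
  · linarith

end Deterministic

/-! ### Restricted strong convexity from sparse approximation -/

section Maurey

variable {V : Type*} [AddCommGroup V] [Module ℝ V]

theorem exists_mem_quadratic_add_le (q : V →ₗ[ℝ] V →ₗ[ℝ] ℝ) {N : Set V} {K : ℝ}
    (hK : ∀ a ∈ N, q a a ≤ K) {y : V} (hy : y ∈ convexHull ℝ N) (x : V) :
    ∃ a ∈ N, q (x + a) (x + a) ≤ q (x + y) (x + y) + (K - q y y) := by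
  by_contra! hcon
  have hN : N ⊆ {a | (q x + q.flip x) y < (q x + q.flip x) a} := by
    intro a ha
    have hxa := hcon a ha
    have haa := hK a ha
    simp only [map_add, LinearMap.add_apply] at hxa
    simp only [Set.mem_ofPred_eq, LinearMap.add_apply, LinearMap.flip_apply]
    linarith
  exact lt_irrefl ((q x + q.flip x) y) (convexHull_min hN
    (convex_halfSpace_gt (LinearMap.isLinear _) _) hy)

/- Maurey's empirical method, derandomised: the expectation over random `a ∈ N` with mean `y`
is replaced by a greedy choice, one summand at a time. -/
theorem exists_sum_quadratic_le (q : V →ₗ[ℝ] V →ₗ[ℝ] ℝ) {N : Set V} {K : ℝ}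
    (hK : ∀ a ∈ N, q a a ≤ K) {y : V} (hy : y ∈ convexHull ℝ N) (s : ℕ) (x : V) :
    ∃ f : Fin s → N, q (x + ∑ i, (f i : V)) (x + ∑ i, (f i : V)) ≤
      q (x + (s : ℝ) • y) (x + (s : ℝ) • y) + s * (K - q y y) := by
  induction s generalizing x with
  | zero => exact ⟨Fin.elim0, by simp⟩
  | succ s ih =>
    obtain ⟨f, hf⟩ := ih (x + y)
    obtain ⟨a, ha, hxa⟩ := exists_mem_quadratic_add_le q hK hy (x + ∑ i, (f i : V))
    refine ⟨Fin.snoc f ⟨a, ha⟩, ?_⟩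
    have hswap : x + ∑ i, (f i : V) + y = x + y + ∑ i, (f i : V) := by abel
    have hsucc : x + ((s : ℝ) + 1) • y = x + y + (s : ℝ) • y := by module
    rw [hswap] at hxa
    simp only [Fin.sum_univ_castSucc, Fin.snoc_castSucc, Fin.snoc_last, ← add_assoc]
    push_cast
    rw [hsucc]
    linarith

theorem neg_le_mul_quadratic_of_mem_convexHull (q : V →ₗ[ℝ] V →ₗ[ℝ] ℝ) {N : Set V} {K : ℝ}
    (hK : ∀ a ∈ N, q a a ≤ K) {s : ℕ} (hs : 0 < s)
    (hq : ∀ f : Fin s → N, 0 ≤ q (∑ i, (f i : V)) (∑ i, (f i : V))) {y : V}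
    (hy : y ∈ convexHull ℝ N) : -K ≤ ((s : ℝ) - 1) * q y y := by
  obtain ⟨f, hf⟩ := exists_sum_quadratic_le q hK hy s 0
  simp only [zero_add, map_smul, LinearMap.smul_apply, smul_eq_mul] at hf
  have hfactor : 0 ≤ (s : ℝ) * (((s : ℝ) - 1) * q y y + K) := by linarith [(hq f).trans hf]
  linarith [nonneg_of_mul_nonneg_right hfactor (by exact_mod_cast hs)]

end Maurey

section RestrictedStrongConvexity

variable {E : Type*} [NormedAddCommGroup E] [InnerProductSpace ℝ E] {n : ℕ}

/-- The bilinear form whose quadratic form is `v ↦ meanSquare x v - c * ‖v‖²`: restricted strong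
convexity of the empirical risk is its positivity up to a small error. -/
noncomputable def curvatureForm (x : Fin n → E) (c : ℝ) : E →ₗ[ℝ] E →ₗ[ℝ] ℝ :=
  (1 / (n : ℝ)) • ∑ i, (innerₗ E (x i)).smulRight (innerₗ E (x i)) - c • innerₗ E

theorem curvatureForm_self (x : Fin n → E) (c : ℝ) (v : E) :
    curvatureForm x c v v = meanSquare x v - c * ‖v‖ ^ 2 := by
  simp [curvatureForm, meanSquare, LinearMap.sum_apply, sq]

theorem neg_le_mul_curvatureForm_of_mem_convexHull (x : Fin n → E) {N : Set E} {c K : ℝ}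
    (hc : 0 ≤ c) {s : ℕ} (hs : 0 < s) (hK : ∀ a ∈ N, meanSquare x a ≤ K)
    (hlow : ∀ f : Fin s → N, c * ‖∑ k, (f k : E)‖ ^ 2 ≤ meanSquare x (∑ k, (f k : E))) {y : E}
    (hy : y ∈ convexHull ℝ N) : -K ≤ ((s : ℝ) - 1) * curvatureForm x c y y := by
  refine neg_le_mul_quadratic_of_mem_convexHull _ (fun a ha => ?_) hs (fun f => ?_) hy
  · rw [curvatureForm_self]
    have : 0 ≤ c * ‖a‖ ^ 2 := by positivity
    linarith [hK a ha]
  · rw [curvatureForm_self]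
    exact sub_nonneg.2 (hlow f)

theorem Tensor.nuclearNorm_zero (d d₃ : ℕ) : (0 : Tensor d d₃).nuclearNorm = 0 := by
  have hslice : ∀ j, (0 : Tensor d d₃).fourierSlice j = 0 := fun j => by
    ext a b
    simp [fourierSlice]
  simp [nuclearNorm, sv, hslice]

theorem Tensor.IsAtomNet.mul_sub_meanSquare_le {d d₃ : ℕ} {N : Finset (Tensor d d₃)}
    (hN : IsAtomNet N) (x : Fin n → Tensor d d₃) {c K : ℝ} (hc : 0 ≤ c) {s : ℕ} (hs : 0 < s)
    (hK : ∀ a ∈ N, meanSquare x a ≤ K)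
    (hlow : ∀ f : Fin s → N, c * ‖∑ k, (f k : Tensor d d₃)‖ ^ 2 ≤
      meanSquare x (∑ k, (f k : Tensor d d₃))) (T : Tensor d d₃) :
    ((s : ℝ) - 1) * (c * ‖T‖ ^ 2 - meanSquare x T) ≤ 16 * K * T.nuclearNorm ^ 2 := by
  rcases eq_or_ne T 0 with rfl | hT
  · simp [meanSquare, nuclearNorm_zero]
  obtain ⟨y, hy, hTy⟩ := hN.exists_mem_convexHull hT
  have hcurv := neg_le_mul_curvatureForm_of_mem_convexHull x (N := (N : Set (Tensor d d₃))) hc hs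
    hK hlow hy
  have hscale : curvatureForm x c T T = (4 * T.nuclearNorm) ^ 2 * curvatureForm x c y y := by
    conv_lhs => rw [hTy]
    simp only [map_smul, LinearMap.smul_apply, smul_eq_mul]
    ring
  rw [curvatureForm_self] at hscale
  linear_combination mul_le_mul_of_nonneg_left hcurv (sq_nonneg (4 * T.nuclearNorm)) -
    ((s : ℝ) - 1) * hscale

end RestrictedStrongConvexity

/-! ### Concentration of sub-Gaussian variables -/

section Concentration

variable {Ω : Type*} [MeasurableSpace Ω] {P : Measure Ω}

theorem measureReal_le_sum_le_exp {ι : Type*} [Fintype ι] {Z : ι → Ω → ℝ}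
    (hZ : ∀ i, Measurable (Z i)) (hind : iIndepFun Z P) {b : ι → ℝ}
    (hb : ∀ i, ∫⁻ ω, ENNReal.ofReal (Real.exp (Z i ω)) ∂P ≤ ENNReal.ofReal (Real.exp (b i)))
    (t : ℝ) : P.real {ω | t ≤ ∑ i, Z i ω} ≤ Real.exp (∑ i, b i - t) := by
  have hexp : Measurable fun z : ℝ => ENNReal.ofReal (Real.exp z) := by fun_prop
  have hprod (c : ι → ℝ) : ENNReal.ofReal (Real.exp (∑ i, c i)) =
      ∏ i, ENNReal.ofReal (Real.exp (c i)) := by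
    rw [Real.exp_sum, ENNReal.ofReal_prod_of_nonneg fun i _ => (Real.exp_pos _).le]
  have hmoment : ∫⁻ ω, ENNReal.ofReal (Real.exp (∑ i, Z i ω)) ∂P ≤
      ENNReal.ofReal (Real.exp (∑ i, b i)) := by
    simp only [hprod]
    rw [lintegral_prod_eq_prod_lintegral_of_indepFun _
      (fun i ω => ENNReal.ofReal (Real.exp (Z i ω))) (hind.comp _ fun _ => hexp)
      fun i => hexp.comp (hZ i)]
    exact Finset.prod_le_prod' fun i _ => hb i
  have hmarkov := (mul_meas_ge_le_lintegral (μ := P)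
    (hexp.comp (Finset.measurable_sum _ fun i _ => hZ i))
    (ENNReal.ofReal (Real.exp t))).trans hmoment
  simp only [Function.comp_apply, ENNReal.ofReal_le_ofReal_iff (Real.exp_pos _).le,
    Real.exp_le_exp] at hmarkov
  have hreal := ENNReal.toReal_mono ENNReal.ofReal_ne_top hmarkov
  rw [ENNReal.toReal_mul, ENNReal.toReal_ofReal (Real.exp_pos _).le,
    ENNReal.toReal_ofReal (Real.exp_pos _).le] at hreal
  rwa [Real.exp_sub, le_div_iff₀' (Real.exp_pos _)]

/-- `W` is sub-Gaussian with `ψ₂` norm at most `√2 * K`. -/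
def HasPsiTwoBound (W : Ω → ℝ) (K : ℝ) (P : Measure Ω) : Prop :=
  ∫⁻ ω, ENNReal.ofReal (Real.exp (W ω ^ 2 / (2 * K ^ 2))) ∂P ≤ 2

theorem IsSubGaussianTensor.hasPsiTwoBound_inner [IsProbabilityMeasure P] {d d₃ : ℕ}
    {Z : Ω → Tensor d d₃} {ν : ℝ} (hZ : IsSubGaussianTensor P Z ν) {u : Tensor d d₃} {D : ℝ}
    (hu : ‖u‖ ≤ D) : HasPsiTwoBound (fun ω => ⟪Z ω, u⟫) (ν * D) P := by
  rcases eq_or_ne u 0 with rfl | hu0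
  · simp [HasPsiTwoBound]
  refine (lintegral_mono fun ω => ENNReal.ofReal_le_ofReal (Real.exp_le_exp.2 ?_)).trans
    (hZ (‖u‖⁻¹ • u) (norm_smul_inv_norm hu0))
  have hD : (D⁻¹) ^ 2 ≤ (‖u‖⁻¹) ^ 2 := by
    have hupos := norm_pos_iff.2 hu0
    gcongr
    exact inv_nonneg.2 (hupos.le.trans hu)
  calc ⟪Z ω, u⟫ ^ 2 / (2 * (ν * D) ^ 2)
      = ⟪Z ω, u⟫ ^ 2 / (2 * ν ^ 2) * (D⁻¹) ^ 2 := by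
        rw [mul_pow, ← mul_assoc, ← div_div, inv_pow, div_eq_mul_inv _ (D ^ 2)]
    _ ≤ ⟪Z ω, u⟫ ^ 2 / (2 * ν ^ 2) * (‖u‖⁻¹) ^ 2 := by gcongr
    _ = ⟪Z ω, ‖u‖⁻¹ • u⟫ ^ 2 / (2 * ν ^ 2) := by
        rw [real_inner_smul_right]
        ring

namespace HasPsiTwoBound

variable {W : Ω → ℝ} {K : ℝ}

theorem lintegral_exp_mul_le [IsProbabilityMeasure P] (h : HasPsiTwoBound W K P)
    (hW : Measurable W) {p : ℝ} (hp0 : 0 ≤ p) (hp1 : p ≤ 1) :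
    ∫⁻ ω, ENNReal.ofReal (Real.exp (p * (W ω ^ 2 / (2 * K ^ 2)))) ∂P ≤
      ENNReal.ofReal (Real.exp p) := by
  have hconv (z : ℝ) : Real.exp (p * z) ≤ (1 - p) + p * Real.exp z := by
    simpa using convexOn_exp.2 (Set.mem_univ 0) (Set.mem_univ z) (sub_nonneg.2 hp1) hp0
      (sub_add_cancel 1 p)
  calc ∫⁻ ω, ENNReal.ofReal (Real.exp (p * (W ω ^ 2 / (2 * K ^ 2)))) ∂P
      ≤ ∫⁻ ω, (ENNReal.ofReal (1 - p) + ENNReal.ofReal p *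
          ENNReal.ofReal (Real.exp (W ω ^ 2 / (2 * K ^ 2)))) ∂P := by
        refine lintegral_mono fun ω => ?_
        rw [← ENNReal.ofReal_mul hp0, ← ENNReal.ofReal_add (by linarith) (by positivity)]
        exact ENNReal.ofReal_le_ofReal (hconv _)
    _ = ENNReal.ofReal (1 - p) + ENNReal.ofReal p *
          ∫⁻ ω, ENNReal.ofReal (Real.exp (W ω ^ 2 / (2 * K ^ 2))) ∂P := by
        rw [lintegral_add_left measurable_const, lintegral_const_mul _ (by fun_prop),
          lintegral_const, measure_univ, mul_one]
    _ ≤ ENNReal.ofReal (1 - p) + ENNReal.ofReal p * ENNReal.ofReal 2 := by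
        gcongr
        rw [ENNReal.ofReal_ofNat]
        exact h
    _ = ENNReal.ofReal (p + 1) := by
        rw [← ENNReal.ofReal_mul hp0, ← ENNReal.ofReal_add (by linarith) (by positivity)]
        ring_nf
    _ ≤ ENNReal.ofReal (Real.exp p) := ENNReal.ofReal_le_ofReal (Real.add_one_le_exp p)

theorem integrable_exp (h : HasPsiTwoBound W K P) (hW : Measurable W) :
    Integrable (fun ω => Real.exp (W ω ^ 2 / (2 * K ^ 2))) P := by
  refine ⟨by fun_prop, ?_⟩
  rw [hasFiniteIntegral_iff_ofReal (ae_of_all _ fun ω => (Real.exp_pos _).le)]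
  exact h.trans_lt ENNReal.ofNat_lt_top

theorem integral_exp_le (h : HasPsiTwoBound W K P) (hW : Measurable W) :
    ∫ ω, Real.exp (W ω ^ 2 / (2 * K ^ 2)) ∂P ≤ 2 := by
  rw [integral_eq_lintegral_of_nonneg_ae (ae_of_all _ fun ω => (Real.exp_pos _).le) (by fun_prop)]
  exact ENNReal.toReal_mono ENNReal.ofNat_ne_top h

theorem integrable_and_integral_le [IsProbabilityMeasure P] (h : HasPsiTwoBound W K P)
    (hW : Measurable W) {g : Ω → ℝ} (hg : Measurable g) (hg0 : ∀ ω, 0 ≤ g ω) {C : ℝ}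
    (hgC : ∀ ω, g ω ≤ C * (Real.exp (W ω ^ 2 / (2 * K ^ 2)) - 1)) (hC : 0 ≤ C) :
    Integrable g P ∧ ∫ ω, g ω ∂P ≤ C := by
  have hexp := h.integrable_exp hW
  have hmaj := (hexp.sub (integrable_const 1)).const_mul C
  have hint : Integrable g P := hmaj.mono' hg.aestronglyMeasurable
    (ae_of_all _ fun ω => (Real.norm_of_nonneg (hg0 ω)).trans_le (hgC ω))
  refine ⟨hint, ?_⟩
  calc ∫ ω, g ω ∂P ≤ ∫ ω, C * (Real.exp (W ω ^ 2 / (2 * K ^ 2)) - 1) ∂P :=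
        integral_mono hint hmaj hgC
    _ = C * (∫ ω, Real.exp (W ω ^ 2 / (2 * K ^ 2)) ∂P - 1) := by
        rw [integral_const_mul, integral_sub hexp (integrable_const 1), integral_const,
          probReal_univ, one_smul]
    _ ≤ C * (2 - 1) := by gcongr; exact h.integral_exp_le hW
    _ = C := by ring

theorem integrable_sq_and_integral_sq_le [IsProbabilityMeasure P] (h : HasPsiTwoBound W K P)
    (hW : Measurable W) (hK : 0 < K) :
    Integrable (fun ω => W ω ^ 2) P ∧ ∫ ω, W ω ^ 2 ∂P ≤ 2 * K ^ 2 := by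
  refine h.integrable_and_integral_le hW (by fun_prop) (fun ω => sq_nonneg _) (fun ω => ?_)
    (by positivity)
  rw [← div_le_iff₀' (by positivity)]
  linarith [Real.add_one_le_exp (W ω ^ 2 / (2 * K ^ 2))]

theorem integrable_pow_four_and_integral_pow_four_le [IsProbabilityMeasure P]
    (h : HasPsiTwoBound W K P) (hW : Measurable W) (hK : 0 < K) :
    Integrable (fun ω => W ω ^ 4) P ∧ ∫ ω, W ω ^ 4 ∂P ≤ 8 * K ^ 4 := by
  refine h.integrable_and_integral_le hW (by fun_prop) (fun ω => by positivity) (fun ω => ?_)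
    (by positivity)
  have hz : 0 ≤ W ω ^ 2 / (2 * K ^ 2) := by positivity
  calc W ω ^ 4 = 8 * K ^ 4 * ((W ω ^ 2 / (2 * K ^ 2)) ^ 2 / 2) := by
        field_simp
        ring
    _ ≤ 8 * K ^ 4 * (Real.exp (W ω ^ 2 / (2 * K ^ 2)) - 1) := by
        gcongr
        linarith [Real.quadratic_le_exp_of_nonneg hz]

end HasPsiTwoBound

theorem exp_neg_le_quadratic {x : ℝ} (hx : 0 ≤ x) : Real.exp (-x) ≤ 1 - x + x ^ 2 / 2 := by
  have hpos : 0 ≤ 1 - x + x ^ 2 / 2 := by nlinarith [sq_nonneg (x - 1)]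
  rw [Real.exp_neg, inv_le_iff_one_le_mul₀ (Real.exp_pos _)]
  nlinarith [mul_le_mul_of_nonneg_left (Real.quadratic_le_exp_of_nonneg hx) hpos,
    sq_nonneg (x ^ 2)]

namespace HasPsiTwoBound

variable {W : Ω → ℝ} {K : ℝ} [IsProbabilityMeasure P]

theorem lintegral_exp_neg_mul_sq_le (h : HasPsiTwoBound W K P)
    (hW : Measurable W) (hK : 0 < K) {s : ℝ} (hs : 0 ≤ s) :
    ∫⁻ ω, ENNReal.ofReal (Real.exp (-(s * W ω ^ 2))) ∂P ≤
      ENNReal.ofReal (Real.exp (4 * K ^ 4 * s ^ 2 - s * ∫ ω, W ω ^ 2 ∂P)) := by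
  obtain ⟨hint2, -⟩ := h.integrable_sq_and_integral_sq_le hW hK
  obtain ⟨hint4, hfourth⟩ := h.integrable_pow_four_and_integral_pow_four_le hW hK
  have hint : Integrable (fun ω => Real.exp (-(s * W ω ^ 2))) P := by
    refine (integrable_const (1 : ℝ)).mono' (by fun_prop) (ae_of_all _ fun ω => ?_)
    rw [Real.norm_of_nonneg (Real.exp_pos _).le, Real.exp_le_one_iff, neg_nonpos]
    positivity
  have hlin : Integrable (fun ω => 1 - s * W ω ^ 2) P :=
    (integrable_const 1).sub (hint2.const_mul s)
  have hquad := hint4.const_mul (s ^ 2 / 2)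
  rw [← ofReal_integral_eq_lintegral_ofReal hint (ae_of_all _ fun ω => (Real.exp_pos _).le)]
  refine ENNReal.ofReal_le_ofReal ?_
  calc ∫ ω, Real.exp (-(s * W ω ^ 2)) ∂P
      ≤ ∫ ω, (1 - s * W ω ^ 2 + s ^ 2 / 2 * W ω ^ 4) ∂P := by
        refine integral_mono hint (hlin.add hquad) fun ω => ?_
        refine (exp_neg_le_quadratic (by positivity)).trans_eq ?_
        ring
    _ = 1 - s * ∫ ω, W ω ^ 2 ∂P + s ^ 2 / 2 * ∫ ω, W ω ^ 4 ∂P := by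
        rw [integral_add hlin hquad, integral_sub (integrable_const 1) (hint2.const_mul s),
          integral_const_mul, integral_const_mul, integral_const, probReal_univ, one_smul]
    _ ≤ 1 - s * ∫ ω, W ω ^ 2 ∂P + s ^ 2 / 2 * (8 * K ^ 4) := by gcongr
    _ = (4 * K ^ 4 * s ^ 2 - s * ∫ ω, W ω ^ 2 ∂P) + 1 := by ring
    _ ≤ _ := Real.add_one_le_exp _

theorem lintegral_exp_mul_mul_le (h : HasPsiTwoBound W K P)
    (hW : Measurable W) (hK : 0 < K) {ε : Ω → ℝ} (hε : Measurable ε) (hind : IndepFun W ε P)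
    {c : ℝ≥0} (hc : HasSubgaussianMGF ε c P) {s : ℝ} (hs : c * s ^ 2 * K ^ 2 ≤ 1) :
    ∫⁻ ω, ENNReal.ofReal (Real.exp (s * (ε ω * W ω))) ∂P ≤
      ENNReal.ofReal (Real.exp (c * s ^ 2 * K ^ 2)) := by
  have hF : Measurable fun p : ℝ × ℝ => ENNReal.ofReal (Real.exp (s * (p.2 * p.1))) := by fun_prop
  have hnoise (x : ℝ) : ∫⁻ ω, ENNReal.ofReal (Real.exp (s * (ε ω * x))) ∂P ≤
      ENNReal.ofReal (Real.exp (c * s ^ 2 * x ^ 2 / 2)) := by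
    have hcomm (ω : Ω) : s * (ε ω * x) = s * x * ε ω := by ring
    simp only [hcomm]
    rw [← ofReal_integral_eq_lintegral_ofReal (hc.integrable_exp_mul _)
      (ae_of_all _ fun ω => (Real.exp_pos _).le)]
    refine ENNReal.ofReal_le_ofReal ((hc.mgf_le (s * x)).trans_eq ?_)
    ring_nf
  calc ∫⁻ ω, ENNReal.ofReal (Real.exp (s * (ε ω * W ω))) ∂P
      = ∫⁻ p, ENNReal.ofReal (Real.exp (s * (p.2 * p.1))) ∂(P.map fun ω => (W ω, ε ω)) :=
        (lintegral_map hF (hW.prodMk hε)).symm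
    _ = ∫⁻ ω, ∫⁻ ω', ENNReal.ofReal (Real.exp (s * (ε ω' * W ω))) ∂P ∂P := by
        rw [(indepFun_iff_map_prod_eq_prod_map_map hW.aemeasurable hε.aemeasurable).1 hind,
          lintegral_prod _ hF.aemeasurable, lintegral_map hF.lintegral_prod_right' hW]
        exact lintegral_congr fun ω => lintegral_map (by fun_prop) hε
    _ ≤ ∫⁻ ω, ENNReal.ofReal (Real.exp (c * s ^ 2 * K ^ 2 * (W ω ^ 2 / (2 * K ^ 2)))) ∂P := by
        refine lintegral_mono fun ω => (hnoise (W ω)).trans_eq ?_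
        congr 2
        field_simp
    _ ≤ _ := h.lintegral_exp_mul_le hW (by positivity) hs

end HasPsiTwoBound

section Tails

variable {ι : Type*} [Fintype ι] {W : ι → Ω → ℝ} {K : ℝ} [IsProbabilityMeasure P]

theorem measureReal_le_sum_sq_le_exp_neg (hW : ∀ i, Measurable (W i)) (hind : iIndepFun W P)
    (h : ∀ i, HasPsiTwoBound (W i) K P) (hK : 0 < K) :
    P.real {ω | 4 * K ^ 2 * Fintype.card ι ≤ ∑ i, W i ω ^ 2} ≤ Real.exp (-Fintype.card ι) := by
  have hg : Measurable fun w : ℝ => w ^ 2 / (2 * K ^ 2) := by fun_prop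
  have hchernoff := measureReal_le_sum_le_exp (fun i => hg.comp (hW i))
    (hind.comp _ fun _ => hg) (b := fun _ => 1) (fun i => by
      simpa using (h i).lintegral_exp_mul_le (hW i) zero_le_one le_rfl) (2 * Fintype.card ι)
  refine (measureReal_mono fun ω hω => ?_).trans (hchernoff.trans_eq ?_)
  · simp only [Set.mem_ofPred_eq, Function.comp_apply, ← Finset.sum_div] at hω ⊢
    rw [le_div_iff₀ (by positivity)]
    linarith
  · simp only [Finset.sum_const, Finset.card_univ, nsmul_eq_mul, mul_one]
    ring_nf

theorem measureReal_sum_sq_le_sub_le_exp_neg (hW : ∀ i, Measurable (W i)) (hind : iIndepFun W P)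
    (h : ∀ i, HasPsiTwoBound (W i) K P) (hK : 0 < K) {t : ℝ} (ht : 0 < t) :
    P.real {ω | ∑ i, W i ω ^ 2 ≤ ∑ i, ∫ ω, W i ω ^ 2 ∂P - Fintype.card ι * t} ≤
      Real.exp (-(t ^ 2 / (16 * K ^ 4) * Fintype.card ι)) := by
  set s := t / (8 * K ^ 4) with hs
  have hs0 : 0 < s := by positivity
  have hg : Measurable fun w : ℝ => -(s * w ^ 2) := by fun_prop
  have hchernoff := measureReal_le_sum_le_exp (fun i => hg.comp (hW i))
    (hind.comp _ fun _ => hg) (fun i => (h i).lintegral_exp_neg_mul_sq_le (hW i) hK hs0.le)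
    (-(s * (∑ i, ∫ ω, W i ω ^ 2 ∂P - Fintype.card ι * t)))
  refine (measureReal_mono fun ω hω => ?_).trans (hchernoff.trans_eq ?_)
  · simp only [Set.mem_ofPred_eq, Function.comp_apply, Finset.sum_neg_distrib,
      ← Finset.mul_sum] at hω ⊢
    exact neg_le_neg (mul_le_mul_of_nonneg_left hω hs0.le)
  · simp only [Finset.sum_sub_distrib, Finset.sum_const, Finset.card_univ, nsmul_eq_mul,
      ← Finset.mul_sum]
    congr 1
    rw [hs]
    field_simp
    ring

theorem measureReal_le_sum_mul_le_exp_neg (hW : ∀ i, Measurable (W i))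
    (h : ∀ i, HasPsiTwoBound (W i) K P) (hK : 0 < K) {ε : ι → Ω → ℝ} (hε : ∀ i, Measurable (ε i))
    (hind : iIndepFun (fun i ω => (W i ω, ε i ω)) P) (hWε : ∀ i, IndepFun (W i) (ε i) P)
    {c : ℝ≥0} (hc : ∀ i, HasSubgaussianMGF (ε i) c P) {τ : ℝ} (hτ : 0 < τ) (hcτ : c ≤ τ ^ 2)
    {x : ℝ} (hx0 : 0 < x) (hx1 : x ≤ 1) (B : ℝ) :
    P.real {ω | Fintype.card ι * (τ * K * (x * (1 + B))) ≤ ∑ i, ε i ω * W i ω} ≤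
      Real.exp (-(B * (Fintype.card ι * x ^ 2))) := by
  set s := x / (τ * K) with hs
  have hs0 : 0 < s := by positivity
  have hsx : c * s ^ 2 * K ^ 2 ≤ x ^ 2 := by
    calc c * s ^ 2 * K ^ 2 ≤ τ ^ 2 * s ^ 2 * K ^ 2 := by gcongr
      _ = x ^ 2 := by rw [hs]; field_simp
  have hg : Measurable fun p : ℝ × ℝ => s * (p.2 * p.1) := by fun_prop
  have hchernoff := measureReal_le_sum_le_exp (fun i => hg.comp ((hW i).prodMk (hε i)))
    (hind.comp _ fun _ => hg) (b := fun _ => x ^ 2)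
    (fun i => ((h i).lintegral_exp_mul_mul_le (hW i) hK (hε i) (hWε i) (hc i)
      (hsx.trans (pow_le_one₀ hx0.le hx1))).trans
        (ENNReal.ofReal_le_ofReal (Real.exp_le_exp.2 hsx)))
    (s * (Fintype.card ι * (τ * K * (x * (1 + B)))))
  refine (measureReal_mono fun ω hω => ?_).trans (hchernoff.trans_eq ?_)
  · simp only [Set.mem_ofPred_eq, Function.comp_apply, ← Finset.mul_sum] at hω ⊢
    exact mul_le_mul_of_nonneg_left hω hs0.le
  · simp only [Finset.sum_const, Finset.card_univ, nsmul_eq_mul]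
    congr 1
    rw [hs]
    field_simp
    ring

end Tails

end Concentration

/-! ### The population Hessian -/

theorem minEigenvalue_mul_dotProduct_le {ι : Type*} [Fintype ι] [DecidableEq ι]
    {M : Matrix ι ι ℝ} (hM : M.IsHermitian) (x : ι → ℝ) :
    minEigenvalue M * (x ⬝ᵥ x) ≤ x ⬝ᵥ M.mulVec x := by
  have hshift : (M - algebraMap ℝ (Matrix ι ι ℝ) (minEigenvalue M)).PosSemidef := by
    refine Matrix.posSemidef_iff_isHermitian_and_spectrum_nonneg.2
      ⟨hM.sub (Matrix.isHermitian_diagonal _), ?_⟩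
    rw [← spectrum.sub_singleton_eq, Set.sub_singleton]
    rintro _ ⟨z, hz, rfl⟩
    exact sub_nonneg.2 (csInf_le M.finite_real_spectrum.bddBelow hz)
  have hnonneg := hshift.dotProduct_mulVec_nonneg x
  rwa [star_trivial, Matrix.sub_mulVec, dotProduct_sub, Algebra.algebraMap_eq_smul_one,
    Matrix.smul_mulVec, Matrix.one_mulVec, dotProduct_smul, smul_eq_mul, sub_nonneg] at hnonneg

/-- The rows of a design: independent `ν`-sub-Gaussian random tensors, not necessarily identically
distributed. -/
structure IsSubGaussianDesign {d d₃ n : ℕ} {Ω : Type*} [MeasurableSpace Ω] (P : Measure Ω)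
    (X : Fin n → Ω → Tensor d d₃) (ν : ℝ) : Prop where
  measurable : ∀ i, Measurable (X i)
  indep : iIndepFun X P
  subGaussian : ∀ i, IsSubGaussianTensor P (X i) ν

section Hessian

variable {d d₃ n : ℕ}

theorem dotProduct_empiricalHessian_mulVec (x : Fin n → Tensor d d₃) (u : Tensor d d₃) :
    u.ofLp ⬝ᵥ (empiricalHessian x).mulVec u.ofLp = meanSquare x u := by
  have hH : empiricalHessian x =
      (1 / (n : ℝ)) • ∑ i, Matrix.vecMulVec (x i).ofLp (x i).ofLp := by
    ext a b
    simp [empiricalHessian, Matrix.sum_apply, Matrix.vecMulVec_apply]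
  have hdot (i : Fin n) : u.ofLp ⬝ᵥ (x i).ofLp = ⟪x i, u⟫ := by
    simp [EuclideanSpace.inner_eq_star_dotProduct]
  rw [hH, Matrix.smul_mulVec, Matrix.sum_mulVec, dotProduct_smul, dotProduct_sum, meanSquare,
    smul_eq_mul]
  congr 1
  refine Finset.sum_congr rfl fun i _ => ?_
  rw [Matrix.vecMulVec_mulVec]
  simp [hdot, dotProduct_comm (x i).ofLp, sq]

variable {Ω : Type*} [MeasurableSpace Ω] {P : Measure Ω}

theorem isHermitian_populationHessian (P : Measure Ω) (X : Fin n → Ω → Tensor d d₃) :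
    (populationHessian P X).IsHermitian := by
  ext a b
  simp only [Matrix.conjTranspose_apply, populationHessian, empiricalHessian, Matrix.of_apply,
    star_trivial, mul_comm]

theorem dotProduct_populationHessian_mulVec {X : Fin n → Ω → Tensor d d₃}
    (hX : ∀ i a, MemLp (fun ω => X i ω a) 2 P) (u : Tensor d d₃) :
    u.ofLp ⬝ᵥ (populationHessian P X).mulVec u.ofLp = ∫ ω, meanSquare (fun i => X i ω) u ∂P := by
  have hint (a b) : Integrable (fun ω => empiricalHessian (fun i => X i ω) a b) P :=
    (integrable_finsetSum _ fun i _ => (hX i a).integrable_mul (hX i b)).const_mul _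
  simp only [← dotProduct_empiricalHessian_mulVec, dotProduct, Matrix.mulVec]
  rw [integral_finsetSum _ fun a _ =>
    (integrable_finsetSum _ fun b _ => (hint a b).mul_const _).const_mul _]
  refine Finset.sum_congr rfl fun a _ => ?_
  rw [integral_const_mul, integral_finsetSum _ fun b _ => (hint a b).mul_const _]
  simp only [integral_mul_const, populationHessian, Matrix.of_apply]

namespace IsSubGaussianDesign

variable {X : Fin n → Ω → Tensor d d₃} {ν : ℝ}

theorem measurable_inner (h : IsSubGaussianDesign P X ν) (i : Fin n) (u : Tensor d d₃) :
    Measurable fun ω => ⟪X i ω, u⟫ :=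
  (h.measurable i).inner_const

variable [IsProbabilityMeasure P]

theorem integrable_inner_sq_and_integral_le (h : IsSubGaussianDesign P X ν) (hν : 0 < ν)
    (i : Fin n) {u : Tensor d d₃} {D : ℝ} (hD : 0 < D) (hu : ‖u‖ ≤ D) :
    Integrable (fun ω => ⟪X i ω, u⟫ ^ 2) P ∧ ∫ ω, ⟪X i ω, u⟫ ^ 2 ∂P ≤ 2 * (ν * D) ^ 2 :=
  ((h.subGaussian i).hasPsiTwoBound_inner hu).integrable_sq_and_integral_sq_le
    (h.measurable_inner i u) (by positivity)

theorem memLp_two_apply (h : IsSubGaussianDesign P X ν) (hν : 0 < ν) (i : Fin n)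
    (a : Fin d × Fin d × Fin d₃) : MemLp (fun ω => X i ω a) 2 P := by
  have hcoord (ω : Ω) : ⟪X i ω, EuclideanSpace.single a (1 : ℝ)⟫ = X i ω a := by
    simp [EuclideanSpace.inner_single_right]
  have hmeas := h.measurable_inner i (EuclideanSpace.single a (1 : ℝ))
  have hint := (h.integrable_inner_sq_and_integral_le hν i (u := EuclideanSpace.single a (1 : ℝ))
    one_pos (by simp)).1
  simp only [hcoord] at hmeas hint
  exact (memLp_two_iff_integrable_sq hmeas.aestronglyMeasurable).2 hint

theorem minEigenvalue_mul_norm_sq_le (h : IsSubGaussianDesign P X ν) (hν : 0 < ν)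
    (u : Tensor d d₃) :
    minEigenvalue (populationHessian P X) * ‖u‖ ^ 2 ≤
      (1 / (n : ℝ)) * ∑ i, ∫ ω, ⟪X i ω, u⟫ ^ 2 ∂P := by
  have hint (i : Fin n) : Integrable (fun ω => ⟪X i ω, u⟫ ^ 2) P :=
    (h.integrable_inner_sq_and_integral_le hν i (D := ‖u‖ + 1) (by positivity) (by simp)).1
  have hnorm : u.ofLp ⬝ᵥ u.ofLp = ‖u‖ ^ 2 := by
    rw [EuclideanSpace.real_norm_sq_eq]
    simp [dotProduct, sq]
  rw [← integral_finsetSum _ fun i _ => hint i, ← integral_const_mul, ← hnorm]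
  exact (minEigenvalue_mul_dotProduct_le (isHermitian_populationHessian P X) _).trans_eq
    (dotProduct_populationHessian_mulVec (h.memLp_two_apply hν) u)

theorem minEigenvalue_le (h : IsSubGaussianDesign P X ν) (hν : 0 < ν) (hd : 0 < d)
    (hd₃ : 0 < d₃) : minEigenvalue (populationHessian P X) ≤ 2 * ν ^ 2 := by
  have hu : ‖(EuclideanSpace.single (⟨0, hd⟩, ⟨0, hd⟩, ⟨0, hd₃⟩) (1 : ℝ) : Tensor d d₃)‖ = 1 := by
    simp
  have hmin := h.minEigenvalue_mul_norm_sq_le hν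
    (EuclideanSpace.single (⟨0, hd⟩, ⟨0, hd⟩, ⟨0, hd₃⟩) (1 : ℝ))
  rw [hu, one_pow, mul_one] at hmin
  refine hmin.trans ?_
  calc (1 / (n : ℝ)) * ∑ i, ∫ ω, ⟪X i ω, EuclideanSpace.single _ (1 : ℝ)⟫ ^ 2 ∂P
      ≤ (1 / (n : ℝ)) * ∑ _i : Fin n, 2 * (ν * 1) ^ 2 := by
        gcongr with i
        exact (h.integrable_inner_sq_and_integral_le hν i one_pos hu.le).2
    _ = (n : ℝ) / n * (2 * ν ^ 2) := by
        simp only [Finset.sum_const, Finset.card_univ, Fintype.card_fin, nsmul_eq_mul]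
        ring
    _ ≤ 2 * ν ^ 2 := mul_le_of_le_one_left (by positivity) (div_self_le_one _)

end IsSubGaussianDesign

end Hessian

/-! ### Deviation bounds over an atom net -/

section Measure

variable {Ω : Type*} [MeasurableSpace Ω] {P : Measure Ω}

theorem measureReal_exists_mem_le_card_mul {α : Type*} {s : Finset α} {p : α → Ω → Prop} {c : ℝ}
    (hp : ∀ a ∈ s, P.real {ω | p a ω} ≤ c) : P.real {ω | ∃ a ∈ s, p a ω} ≤ s.card * c := by
  calc P.real {ω | ∃ a ∈ s, p a ω} = P.real (⋃ a ∈ s, {ω | p a ω}) := by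
        congr 1
        ext ω
        simp
    _ ≤ ∑ a ∈ s, P.real {ω | p a ω} := measureReal_biUnion_finset_le s _
    _ ≤ s.card * c := (Finset.sum_le_card_nsmul s _ c hp).trans_eq (nsmul_eq_mul _ _)

theorem exists_measurableSet_forall_notMem_of_measureReal_le [IsProbabilityMeasure P] {S : Set Ω}
    {p : ℝ} (hS : P.real S ≤ p) : ∃ E, MeasurableSet E ∧ 1 - p ≤ P.real E ∧ ∀ ω ∈ E, ω ∉ S := by
  have hmeas := measurableSet_toMeasurable P S
  refine ⟨(toMeasurable P S)ᶜ, hmeas.compl, ?_, fun ω hω hωS => hω (subset_toMeasurable P S hωS)⟩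
  rw [measureReal_compl hmeas, probReal_univ, measureReal_def, measure_toMeasurable,
    ← measureReal_def]
  linarith

end Measure

/-- Observations of the linear model with design `X` and noise `ε`: the pairs `(X i, ε i)` are
independent but need not be identically distributed, the design is `ν`-sub-Gaussian, and each `ε i`
is independent of `X i` with the moment generating function of `N(0, σ²)` as an upper bound. -/
structure IsSubGaussianSample {d d₃ n : ℕ} {Ω : Type*} [MeasurableSpace Ω] (P : Measure Ω)
    (X : Fin n → Ω → Tensor d d₃) (y ε : Fin n → Ω → ℝ) (B₀ : Tensor d d₃) (ν : ℝ)
    (σ : ℝ≥0) : Prop where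
  measurable_X : ∀ i, Measurable (X i)
  measurable_noise : ∀ i, Measurable (ε i)
  response : ∀ i ω, y i ω = ⟪X i ω, B₀⟫ + ε i ω
  indep : iIndepFun (fun i ω => (X i ω, ε i ω)) P
  indep_noise : ∀ i, IndepFun (X i) (ε i) P
  subGaussian_X : ∀ i, IsSubGaussianTensor P (X i) ν
  subgaussian_noise : ∀ i, HasSubgaussianMGF (ε i) (σ ^ 2) P

section Deviation

variable {d d₃ n : ℕ} {Ω : Type*} [MeasurableSpace Ω] {P : Measure Ω}
  {X : Fin n → Ω → Tensor d d₃} {ν : ℝ}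

namespace IsSubGaussianDesign

theorem iIndepFun_inner (h : IsSubGaussianDesign P X ν) (u : Tensor d d₃) :
    iIndepFun (fun i ω => ⟪X i ω, u⟫) P :=
  h.indep.comp (fun _ x => ⟪x, u⟫) fun _ => measurable_id.inner_const

variable [IsProbabilityMeasure P]

theorem measureReal_lt_meanSquare_le (h : IsSubGaussianDesign P X ν) (hν : 0 < ν) (hn : 0 < n)
    {u : Tensor d d₃} {D : ℝ} (hD : 0 < D) (hu : ‖u‖ ≤ D) :
    P.real {ω | 4 * (ν * D) ^ 2 < meanSquare (fun i => X i ω) u} ≤ Real.exp (-n) := by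
  have htail := measureReal_le_sum_sq_le_exp_neg (fun i => h.measurable_inner i u)
    (h.iIndepFun_inner u) (fun i => (h.subGaussian i).hasPsiTwoBound_inner hu) (mul_pos hν hD)
  rw [Fintype.card_fin] at htail
  refine (measureReal_mono fun ω hω => ?_).trans htail
  simp only [Set.mem_ofPred_eq, meanSquare] at hω ⊢
  rw [one_div, ← div_eq_inv_mul, lt_div_iff₀ (by positivity)] at hω
  exact hω.le

theorem measureReal_meanSquare_lt_le (h : IsSubGaussianDesign P X ν) (hν : 0 < ν) (hn : 0 < n)
    {Λ : ℝ} (hΛ : 0 < Λ) (hmin : Λ ≤ minEigenvalue (populationHessian P X)) (u : Tensor d d₃) :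
    P.real {ω | meanSquare (fun i => X i ω) u < 2 / 3 * Λ * ‖u‖ ^ 2} ≤
      Real.exp (-(Λ ^ 2 / (144 * ν ^ 4) * n)) := by
  rcases eq_or_ne u 0 with rfl | hu0
  · simp [meanSquare, Real.exp_nonneg]
  have hu : 0 < ‖u‖ := norm_pos_iff.2 hu0
  have hmean : n * (Λ * ‖u‖ ^ 2) ≤ ∑ i, ∫ ω, ⟪X i ω, u⟫ ^ 2 ∂P := by
    have hmul := (mul_le_mul_of_nonneg_right hmin (sq_nonneg ‖u‖)).trans
      (h.minEigenvalue_mul_norm_sq_le hν u)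
    rwa [one_div, ← div_eq_inv_mul, le_div_iff₀' (by positivity)] at hmul
  have htail := measureReal_sum_sq_le_sub_le_exp_neg (fun i => h.measurable_inner i u)
    (h.iIndepFun_inner u) (fun i => (h.subGaussian i).hasPsiTwoBound_inner le_rfl)
    (mul_pos hν hu) (t := Λ * ‖u‖ ^ 2 / 3) (by positivity)
  rw [Fintype.card_fin] at htail
  refine (measureReal_mono fun ω hω => ?_).trans (htail.trans_eq ?_)
  · simp only [Set.mem_ofPred_eq, meanSquare] at hω ⊢
    rw [one_div, ← div_eq_inv_mul, div_lt_iff₀' (by positivity)] at hω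
    linarith
  · congr 3
    field_simp
    ring

end IsSubGaussianDesign

namespace IsSubGaussianSample

variable {y ε : Fin n → Ω → ℝ} {B₀ : Tensor d d₃} {σ : ℝ≥0}

theorem isSubGaussianDesign (h : IsSubGaussianSample P X y ε B₀ ν σ) :
    IsSubGaussianDesign P X ν where
  measurable := h.measurable_X
  indep := h.indep.comp (fun _ => Prod.fst) fun _ => measurable_fst
  subGaussian := h.subGaussian_X

variable [IsProbabilityMeasure P]

theorem measureReal_lt_inner_noise_le (h : IsSubGaussianSample P X y ε B₀ ν σ) (hν : 0 < ν)
    (hn : 0 < n) {u : Tensor d d₃} {D : ℝ} (hD : 0 < D) (hu : ‖u‖ ≤ D) {x : ℝ} (hx0 : 0 < x)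
    (hx1 : x ≤ 1) (B : ℝ) :
    P.real {ω | (σ + 1) * (ν * D) * (x * (1 + B)) < ⟪(1 / (n : ℝ)) • ∑ i, ε i ω • X i ω, u⟫} ≤
      Real.exp (-(B * (n * x ^ 2))) := by
  have hg : Measurable fun p : Tensor d d₃ × ℝ => (⟪p.1, u⟫, p.2) := by fun_prop
  have htail := measureReal_le_sum_mul_le_exp_neg (τ := σ + 1)
    (fun i => h.isSubGaussianDesign.measurable_inner i u)
    (fun i => (h.subGaussian_X i).hasPsiTwoBound_inner hu) (mul_pos hν hD) h.measurable_noise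
    (h.indep.comp _ fun _ => hg)
    (fun i => (h.indep_noise i).comp (measurable_id.inner_const (c := u)) measurable_id)
    h.subgaussian_noise (by positivity) (by push_cast; gcongr; simp) hx0 hx1 B
  rw [Fintype.card_fin] at htail
  refine (measureReal_mono fun ω hω => ?_).trans htail
  simp only [Set.mem_ofPred_eq, real_inner_smul_left, sum_inner] at hω ⊢
  rw [one_div, ← div_eq_inv_mul, lt_div_iff₀' (by positivity)] at hω
  exact hω.le

end IsSubGaussianSample

end Deviation

section NetDeviation

variable {d d₃ n : ℕ} {Ω : Type*} [MeasurableSpace Ω] {P : Measure Ω}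
  {X : Fin n → Ω → Tensor d d₃} {ν A : ℝ} {N : Finset (Tensor d d₃)}

theorem Tensor.IsAtomNet.card_le_exp (hN : Tensor.IsAtomNet N) :
    (N.card : ℝ) ≤ d₃ * Real.exp (7 * d) := by
  have h625 : (625 : ℝ) ≤ Real.exp 7 := by
    calc (625 : ℝ) ≤ 2.7182818283 ^ 7 := by norm_num
      _ ≤ Real.exp 1 ^ 7 := by gcongr; exact Real.exp_one_gt_d9.le
      _ = Real.exp 7 := by exact_mod_cast Real.exp_one_pow 7
  calc (N.card : ℝ) ≤ d₃ * 625 ^ d := by exact_mod_cast hN.card_le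
    _ ≤ d₃ * Real.exp 7 ^ d := by gcongr
    _ = d₃ * Real.exp (7 * d) := by rw [← Real.exp_nat_mul, mul_comm (d : ℝ)]

theorem Tensor.IsAtomNet.norm_le (hN : Tensor.IsAtomNet N) {a : Tensor d d₃} (ha : a ∈ N) :
    ‖a‖ ≤ √d₃ :=
  Real.le_sqrt_of_sq_le (hN.norm_sq_le a ha)

theorem Tensor.IsAtomNet.measureReal_exists_mem_le (hN : Tensor.IsAtomNet N)
    {p : Tensor d d₃ → Ω → Prop}
    (hp : ∀ a ∈ N, P.real {ω | p a ω} ≤ Real.exp (-((A + 9) * d))) :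
    P.real {ω | ∃ a ∈ N, p a ω} ≤ d₃ * Real.exp (-((A + 2) * d)) := by
  calc P.real {ω | ∃ a ∈ N, p a ω}
      ≤ N.card * Real.exp (-((A + 9) * d)) := measureReal_exists_mem_le_card_mul hp
    _ ≤ d₃ * Real.exp (7 * d) * Real.exp (-((A + 9) * d)) := by gcongr; exact hN.card_le_exp
    _ = d₃ * Real.exp (-((A + 2) * d)) := by
        rw [mul_assoc, ← Real.exp_add]
        ring_nf

variable [IsProbabilityMeasure P]

theorem IsSubGaussianSample.measureReal_exists_lt_inner_noise_le {y ε : Fin n → Ω → ℝ}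
    {B₀ : Tensor d d₃} {σ : ℝ≥0} (h : IsSubGaussianSample P X y ε B₀ ν σ) (hν : 0 < ν)
    (hd : 0 < d) (hd₃ : 0 < d₃) {β : ℝ} (hβ : 0 < β) (hdn : d / β ^ 2 ≤ n) (A : ℝ) :
    P.real {ω | ∃ T : Tensor d d₃,
      4 * (σ + 1) * ν * (β⁻¹ + (A + 9) * β) * √((d : ℝ) * d₃ / n) * T.nuclearNorm <
        ⟪(1 / (n : ℝ)) • ∑ i, ε i ω • X i ω, T⟫} ≤ d₃ * Real.exp (-((A + 2) * d)) := by
  have hn : 0 < n := Nat.cast_pos.1 ((show (0 : ℝ) < d / β ^ 2 by positivity).trans_le hdn)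
  obtain ⟨N, hN⟩ := Tensor.exists_isAtomNet d d₃
  set x := √((d : ℝ) / n) / β with hx
  have hx0 : 0 < x := by positivity
  have hxsq : n * x ^ 2 = d / β ^ 2 := by
    rw [hx, div_pow, Real.sq_sqrt (by positivity)]
    field_simp
  have hx1 : x ≤ 1 := by
    rw [hx, div_le_one hβ]
    refine Real.sqrt_le_iff.2 ⟨hβ.le, ?_⟩
    rwa [div_le_iff₀ (by positivity), ← div_le_iff₀' (by positivity)]
  have hthreshold : (σ + 1) * (ν * √d₃) * (x * (1 + (A + 9) * β ^ 2)) =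
      (σ + 1) * ν * (β⁻¹ + (A + 9) * β) * √((d : ℝ) * d₃ / n) := by
    rw [hx, mul_div_right_comm, Real.sqrt_mul (by positivity)]
    field_simp
  have htail (a) (ha : a ∈ N) := (h.measureReal_lt_inner_noise_le hν hn (by positivity)
    (hN.norm_le ha) hx0 hx1 ((A + 9) * β ^ 2)).trans_eq
      (show _ = Real.exp (-((A + 9) * d)) by rw [hxsq]; field_simp)
  refine (measureReal_mono fun ω hω => ?_).trans (hN.measureReal_exists_mem_le htail)
  obtain ⟨T, hT⟩ := hω
  by_contra! hall
  simp only [Set.mem_ofPred_eq, not_exists, not_and, not_lt] at hall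
  refine hT.not_ge ((hN.inner_le _ T _ hall).trans_eq ?_)
  rw [hthreshold]
  ring

namespace IsSubGaussianDesign

theorem measureReal_exists_mem_lt_meanSquare_le (h : IsSubGaussianDesign P X ν) (hν : 0 < ν)
    (hd₃ : 0 < d₃) (hn : 0 < n) (hN : Tensor.IsAtomNet N) (hdn : (A + 9) * d ≤ n) :
    P.real {ω | ∃ a ∈ N, 4 * ν ^ 2 * d₃ < meanSquare (fun i => X i ω) a} ≤
      d₃ * Real.exp (-((A + 2) * d)) := by
  refine hN.measureReal_exists_mem_le fun a ha => ?_
  have htail := h.measureReal_lt_meanSquare_le hν hn (by positivity) (hN.norm_le ha)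
  rw [mul_pow, Real.sq_sqrt (by positivity), ← mul_assoc] at htail
  exact htail.trans (Real.exp_le_exp.2 (neg_le_neg hdn))

theorem measureReal_exists_meanSquare_sum_lt_le (h : IsSubGaussianDesign P X ν) (hν : 0 < ν)
    (hd₃ : 0 < d₃) (hn : 0 < n) (hN : Tensor.IsAtomNet N) {Λ : ℝ} (hΛ : 0 < Λ)
    (hmin : Λ ≤ minEigenvalue (populationHessian P X)) (hA : d₃ ≤ Real.exp (A * d)) {s : ℕ}
    (hs : (A + 7) * d * s + (A + 2) * d ≤ Λ ^ 2 / (144 * ν ^ 4) * n) :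
    P.real {ω | ∃ f : Fin s → N, meanSquare (fun i => X i ω) (∑ k, (f k : Tensor d d₃)) <
      2 / 3 * Λ * ‖∑ k, (f k : Tensor d d₃)‖ ^ 2} ≤ d₃ * Real.exp (-((A + 2) * d)) := by
  have hcard : (N.card : ℝ) ≤ Real.exp ((A + 7) * d) := by
    refine hN.card_le_exp.trans ((mul_le_mul_of_nonneg_right hA (Real.exp_pos _).le).trans_eq ?_)
    rw [← Real.exp_add]
    ring_nf
  have hunion := measureReal_exists_mem_le_card_mul (P := P) (s := Finset.univ)
    fun (f : Fin s → N) _ =>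
      h.measureReal_meanSquare_lt_le hν hn hΛ hmin (∑ k, (f k : Tensor d d₃))
  simp only [Finset.mem_univ, true_and, Finset.card_univ, Fintype.card_fun, Fintype.card_fin,
    Fintype.card_coe, Nat.cast_pow] at hunion
  calc _ ≤ (N.card : ℝ) ^ s * Real.exp (-(Λ ^ 2 / (144 * ν ^ 4) * n)) := hunion
    _ ≤ Real.exp ((A + 7) * d) ^ s * Real.exp (-(Λ ^ 2 / (144 * ν ^ 4) * n)) := by gcongr
    _ = Real.exp ((A + 7) * d * s - Λ ^ 2 / (144 * ν ^ 4) * n) := by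
        rw [← Real.exp_nat_mul, ← Real.exp_add]
        ring_nf
    _ ≤ 1 * Real.exp (-((A + 2) * d)) := by
        rw [one_mul]
        exact Real.exp_le_exp.2 (by linarith)
    _ ≤ d₃ * Real.exp (-((A + 2) * d)) := by gcongr; exact_mod_cast hd₃

end IsSubGaussianDesign

end NetDeviation

/-! ### The good event -/

/-- A ratio `M` such that the quadratic restricted strong convexity bound of
`IsSubGaussianDesign.measureReal_exists_quadratic_lt_le` is available once `M * d ≤ n`; the last
summand makes room for a Maurey approximation by an average of at least two atoms. -/
noncomputable def sampleSizeRatio (ν Λ A : ℝ) : ℝ :=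
  A + 9 + 8 * (A + 7) / (Λ ^ 2 / (144 * ν ^ 4))

/-- The factor of `√(d * d₃ / n)` in the tuning parameter that dominates both the noise (first
summand) and the curvature deficit of the empirical risk (second summand) on the ball of radius
`β`. -/
noncomputable def errorRate (σ ν Λ β A : ℝ) : ℝ :=
  4 * (σ + 1) * ν * (β⁻¹ + (A + 9) * β) + 7 * ν ^ 2 * β * √(sampleSizeRatio ν Λ A)

theorem sampleSizeRatio_pos {ν Λ A : ℝ} (hA : 0 < A) : 0 < sampleSizeRatio ν Λ A := by
  unfold sampleSizeRatio
  positivity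

theorem errorRate_pos {σ ν Λ β A : ℝ} (hσ : 0 ≤ σ) (hν : 0 < ν) (hβ : 0 < β) (hA : 0 < A) :
    0 < errorRate σ ν Λ β A := by
  unfold errorRate
  positivity

theorem errorRate_anti {σ ν κ Λ β A : ℝ} (hκ : 0 < κ) (hκΛ : κ ≤ Λ) (hν : 0 < ν) (hβ : 0 < β)
    (hA : 0 < A) : errorRate σ ν Λ β A ≤ errorRate σ ν κ β A := by
  unfold errorRate sampleSizeRatio
  gcongr

theorem exists_nat_mul_le_and_le_sub_one {b z : ℝ} (hb : 0 < b) (hz : 8 * b ≤ z) :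
    ∃ s : ℕ, 0 < s ∧ b * s ≤ z / 2 ∧ z / (4 * b) ≤ (s : ℝ) - 1 := by
  have hfloor := Nat.lt_floor_add_one (z / (2 * b))
  have hhalf : z / (2 * b) = 2 * (z / (4 * b)) := by
    field_simp
    ring
  have hquarter : 2 ≤ z / (4 * b) := by
    rw [le_div_iff₀ (by positivity)]
    linarith
  refine ⟨⌊z / (2 * b)⌋₊, Nat.floor_pos.2 (by linarith), ?_, by linarith⟩
  calc b * ⌊z / (2 * b)⌋₊ ≤ b * (z / (2 * b)) := by gcongr; exact Nat.floor_le (by linarith)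
    _ = z / 2 := by field_simp

theorem exists_average_length {ν Λ A d n : ℝ} (hν : 0 < ν) (hΛ : 0 < Λ) (hA : 0 < A) (hd : 0 < d)
    (hn : sampleSizeRatio ν Λ A * d ≤ n) :
    (A + 9) * d ≤ n ∧ ∃ s : ℕ, 0 < s ∧
      (A + 7) * d * s + (A + 2) * d ≤ Λ ^ 2 / (144 * ν ^ 4) * n ∧
      Λ ^ 2 / (144 * ν ^ 4) * n / (4 * ((A + 7) * d)) ≤ (s : ℝ) - 1 := by
  rw [sampleSizeRatio, add_mul] at hn
  have hδ : 0 < Λ ^ 2 / (144 * ν ^ 4) := by positivity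
  have hlarge : 8 * ((A + 7) * d) ≤ Λ ^ 2 / (144 * ν ^ 4) * n := by
    have hle : 8 * (A + 7) / (Λ ^ 2 / (144 * ν ^ 4)) * d ≤ n :=
      (le_add_of_nonneg_left (by positivity)).trans hn
    rwa [div_mul_eq_mul_div, div_le_iff₀' hδ, mul_assoc 8] at hle
  obtain ⟨s, hs0, hs, hs1⟩ := exists_nat_mul_le_and_le_sub_one (by positivity) hlarge
  refine ⟨(le_add_of_nonneg_right (by positivity)).trans hn, s, hs0, ?_, hs1⟩
  nlinarith [mul_pos hA hd]

theorem sub_mul_le_of_sub_le_mul_sq {u v w a q D : ℝ} (huD : u ≤ D) (hv : 0 ≤ v) (hw : 0 ≤ w)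
    (hq : 0 ≤ q) (huv : u - v ≤ a * w ^ 2) (haD : D * a ≤ q ^ 2) : u - q * w ≤ v := by
  rcases le_total u v with hle | hle
  · exact (sub_le_self _ (mul_nonneg hq hw)).trans hle
  have hsq : (u - v) ^ 2 ≤ (q * w) ^ 2 := by
    have hD : 0 ≤ D := (hv.trans hle).trans huD
    calc (u - v) ^ 2 = (u - v) * (u - v) := sq _
      _ ≤ D * (a * w ^ 2) := mul_le_mul (by linarith) huv (by linarith) hD
      _ = D * a * w ^ 2 := by ring
      _ ≤ q ^ 2 * w ^ 2 := by gcongr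
      _ = (q * w) ^ 2 := (mul_pow _ _ _).symm
  linarith [le_of_sq_le_sq hsq (mul_nonneg hq hw)]

theorem add_two_mul_exp_neg_le {c A d : ℝ} (hc : 0 ≤ c) (hd : 1 ≤ d) :
    c * Real.exp (-((A + 2) * d)) + 2 * (c * Real.exp (-((A + 2) * d))) ≤
      c * Real.exp (-(A * d)) := by
  have hexp : 3 * Real.exp (-(2 * d)) ≤ 1 := by
    rw [Real.exp_neg, mul_inv_le_iff₀ (Real.exp_pos _), one_mul]
    linarith [Real.add_one_le_exp (2 * d)]
  calc c * Real.exp (-((A + 2) * d)) + 2 * (c * Real.exp (-((A + 2) * d)))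
      = c * Real.exp (-(A * d)) * (3 * Real.exp (-(2 * d))) := by
        rw [show -((A + 2) * d) = -(A * d) + -(2 * d) by ring, Real.exp_add]
        ring
    _ ≤ c * Real.exp (-(A * d)) := mul_le_of_le_one_right (by positivity) hexp

theorem Tensor.curvature_le_nuclearNorm {d d₃ : ℕ} (T : Tensor d d₃) {ν Λ β M η : ℝ}
    (hΛ : Λ ≤ 2 * ν ^ 2) (hT : ‖T‖ ≤ β) (hβ : 0 ≤ β) (hη : 0 ≤ η) (hd₃ : d₃ ≤ M * η) :
    2 / 3 * Λ * ‖T‖ ^ 2 ≤ 7 * ν ^ 2 * β * √M * √η * T.nuclearNorm := by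
  have hw := T.nuclearNorm_nonneg
  calc 2 / 3 * Λ * ‖T‖ ^ 2 = 2 / 3 * Λ * (‖T‖ * ‖T‖) := by ring
    _ ≤ 2 / 3 * (2 * ν ^ 2) * (β * (√d₃ * T.nuclearNorm)) := by
        gcongr
        exact T.norm_le_sqrt_mul_nuclearNorm
    _ = 4 / 3 * (ν ^ 2 * β * T.nuclearNorm * √d₃) := by ring
    _ ≤ 7 * (ν ^ 2 * β * T.nuclearNorm * (√M * √η)) := by
        gcongr
        · norm_num
        · rw [← Real.sqrt_mul' M hη]
          exact Real.sqrt_le_sqrt hd₃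
    _ = _ := by ring

section GoodEvent

variable {d d₃ n : ℕ} {Ω : Type*} [MeasurableSpace Ω] {P : Measure Ω} [IsProbabilityMeasure P]
  {X : Fin n → Ω → Tensor d d₃} {ν Λ A : ℝ}

namespace IsSubGaussianDesign

theorem measureReal_exists_quadratic_lt_le (h : IsSubGaussianDesign P X ν) (hν : 0 < ν)
    (hd : 0 < d) (hd₃ : 0 < d₃) (hΛ : 0 < Λ)
    (hmin : Λ ≤ minEigenvalue (populationHessian P X)) (hA0 : 0 < A) (hA : d₃ ≤ Real.exp (A * d))
    (hdn : sampleSizeRatio ν Λ A * d ≤ n) :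
    P.real {ω | ∃ T : Tensor d d₃, 32 * ν ^ 2 * (sampleSizeRatio ν Λ A * (d * d₃ / n)) *
        T.nuclearNorm ^ 2 < 2 / 3 * Λ * ‖T‖ ^ 2 - meanSquare (fun i => X i ω) T} ≤
      2 * (d₃ * Real.exp (-((A + 2) * d))) := by
  have hn : 0 < n := Nat.cast_pos.1 (lt_of_lt_of_le
    (mul_pos (sampleSizeRatio_pos hA0) (Nat.cast_pos.2 hd)) hdn)
  obtain ⟨N, hN⟩ := Tensor.exists_isAtomNet d d₃
  obtain ⟨hn9, s, hs0, hbudget, hs⟩ := exists_average_length hν hΛ hA0 (by exact_mod_cast hd) hdn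
  refine (measureReal_mono fun ω hω => ?_).trans ((measureReal_union_le _ _).trans
    ((add_le_add (h.measureReal_exists_mem_lt_meanSquare_le hν hd₃ hn hN hn9)
      (h.measureReal_exists_meanSquare_sum_lt_le hν hd₃ hn hN hΛ hmin hA hbudget)).trans_eq
      (two_mul _).symm))
  obtain ⟨T, hT⟩ := hω
  by_contra! hgood
  simp only [Set.mem_union, Set.mem_ofPred_eq, not_or, not_exists, not_and, not_lt] at hgood
  have hmaurey := hN.mul_sub_meanSquare_le (fun i => X i ω) (by positivity) hs0 hgood.1 hgood.2 T
  set v := 2 / 3 * Λ * ‖T‖ ^ 2 - meanSquare (fun i => X i ω) T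
  set δ := Λ ^ 2 / (144 * ν ^ 4)
  have hδ0 : 0 < δ := by positivity
  have hM : 8 * (A + 7) / δ ≤ sampleSizeRatio ν Λ A := le_add_of_nonneg_left (by positivity)
  have hv : 0 ≤ v := le_trans
    (by have := sampleSizeRatio_pos (ν := ν) (Λ := Λ) hA0; positivity) hT.le
  refine hT.not_ge ?_
  calc v = δ * n / (4 * ((A + 7) * d)) * v * (4 * ((A + 7) * d) / (δ * n)) := by field_simp
    _ ≤ 16 * (4 * ν ^ 2 * d₃) * T.nuclearNorm ^ 2 * (4 * ((A + 7) * d) / (δ * n)) := by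
        gcongr ?_ * _
        exact (mul_le_mul_of_nonneg_right hs hv).trans hmaurey
    _ = 32 * ν ^ 2 * (8 * (A + 7) / δ * (d * d₃ / n)) * T.nuclearNorm ^ 2 := by
        field_simp
        ring
    _ ≤ _ := by gcongr

theorem measureReal_exists_meanSquare_lt_le (h : IsSubGaussianDesign P X ν) (hν : 0 < ν)
    (hd : 0 < d) (hd₃ : 0 < d₃) (hn : 0 < n) (hΛ : 0 < Λ)
    (hmin : Λ ≤ minEigenvalue (populationHessian P X)) (hA0 : 0 < A) (hA : d₃ ≤ Real.exp (A * d))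
    {β : ℝ} (hβ : 0 < β) :
    P.real {ω | ∃ T : Tensor d d₃, ‖T‖ ≤ β ∧ meanSquare (fun i => X i ω) T <
        2 / 3 * Λ * ‖T‖ ^ 2 - 7 * ν ^ 2 * β * √(sampleSizeRatio ν Λ A) * √((d : ℝ) * d₃ / n) *
          T.nuclearNorm} ≤ 2 * (d₃ * Real.exp (-((A + 2) * d))) := by
  set M := sampleSizeRatio ν Λ A
  have hM : 0 < M := sampleSizeRatio_pos hA0
  have hΛν : Λ ≤ 2 * ν ^ 2 := hmin.trans (h.minEigenvalue_le hν hd hd₃)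
  rcases le_total (n : ℝ) (M * d) with hsmall | hlarge
  · refine (congrArg P.real (Set.eq_empty_of_forall_notMem ?_)).trans_le
      (measureReal_empty.trans_le (by positivity))
    rintro ω ⟨T, hTβ, hT⟩
    refine hT.not_ge ((sub_nonpos.2 ?_).trans (meanSquare_nonneg _ _))
    refine T.curvature_le_nuclearNorm hΛν hTβ hβ.le (by positivity) ?_
    rw [← mul_div_assoc, le_div_iff₀' (by positivity), ← mul_assoc]
    gcongr
  · refine (measureReal_mono fun ω hω => ?_).trans
      (h.measureReal_exists_quadratic_lt_le hν hd hd₃ hΛ hmin hA0 hA hlarge)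
    obtain ⟨T, hTβ, hT⟩ := hω
    refine ⟨T, lt_of_not_ge fun hquad => hT.not_ge ?_⟩
    have hu : 2 / 3 * Λ * ‖T‖ ^ 2 ≤ 4 / 3 * ν ^ 2 * β ^ 2 := by
      calc 2 / 3 * Λ * ‖T‖ ^ 2 ≤ 2 / 3 * (2 * ν ^ 2) * β ^ 2 := by gcongr
        _ = _ := by ring
    refine sub_mul_le_of_sub_le_mul_sq hu (meanSquare_nonneg _ _) T.nuclearNorm_nonneg
      (by positivity) hquad ?_
    simp only [mul_pow, Real.sq_sqrt hM.le, Real.sq_sqrt (show 0 ≤ (d : ℝ) * d₃ / n by positivity)]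
    calc 4 / 3 * ν ^ 2 * β ^ 2 * (32 * ν ^ 2 * (M * (d * d₃ / n)))
        = 128 / 3 * (ν ^ 4 * β ^ 2 * (M * (d * d₃ / n))) := by ring
      _ ≤ 49 * (ν ^ 4 * β ^ 2 * (M * (d * d₃ / n))) := by gcongr; norm_num
      _ = _ := by ring

end IsSubGaussianDesign

theorem IsSubGaussianSample.exists_goodEvent {y ε : Fin n → Ω → ℝ} {B₀ : Tensor d d₃} {σ : ℝ≥0}
    (h : IsSubGaussianSample P X y ε B₀ ν σ) (hν : 0 < ν) (hd : 0 < d) (hd₃ : 0 < d₃)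
    (hΛ : 0 < Λ) (hmin : Λ ≤ minEigenvalue (populationHessian P X)) (hA : 0 < A) {β q : ℝ}
    (hβ : 0 < β) (hdn : d / β ^ 2 ≤ n) (hq : errorRate σ ν Λ β A * √((d : ℝ) * d₃ / n) ≤ q) :
    ∃ E, MeasurableSet E ∧ 1 - d₃ * Real.exp (-(A * d)) ≤ P.real E ∧
      ∀ ω ∈ E, ∀ T : Tensor d d₃, ‖T‖ ≤ β →
        ⟪(1 / (n : ℝ)) • ∑ i, ε i ω • X i ω, T⟫ ≤ q * T.nuclearNorm ∧
        2 / 3 * Λ * ‖T‖ ^ 2 - q * T.nuclearNorm ≤ meanSquare (fun i => X i ω) T := by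
  rcases le_or_gt 1 (d₃ * Real.exp (-(A * d))) with htrivial | hd₃A
  · exact ⟨∅, .empty, by simpa using htrivial, fun ω hω => hω.elim⟩
  have hA' : d₃ ≤ Real.exp (A * d) := by
    rw [Real.exp_neg, mul_inv_lt_iff₀ (Real.exp_pos _), one_mul] at hd₃A
    exact hd₃A.le
  have hn : 0 < n := Nat.cast_pos.1 ((show (0 : ℝ) < d / β ^ 2 by positivity).trans_le hdn)
  have hnoise := h.measureReal_exists_lt_inner_noise_le hν hd hd₃ hβ hdn A
  have hcurv := h.isSubGaussianDesign.measureReal_exists_meanSquare_lt_le hν hd hd₃ hn hΛ hmin hA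
    hA' hβ
  obtain ⟨E, hE, hPE, hgood⟩ := exists_measurableSet_forall_notMem_of_measureReal_le
    ((measureReal_union_le _ _).trans ((add_le_add hnoise hcurv).trans
      (add_two_mul_exp_neg_le d₃.cast_nonneg (A := A) (d := d) (by exact_mod_cast hd))))
  rw [errorRate, add_mul] at hq
  refine ⟨E, hE, hPE, fun ω hω T hT => ?_⟩
  have hω := hgood ω hω
  simp only [Set.mem_union, Set.mem_ofPred_eq, not_or, not_exists, not_and, not_lt] at hω
  refine ⟨(hω.1 T).trans (mul_le_mul_of_nonneg_right ?_ T.nuclearNorm_nonneg),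
    le_trans (sub_le_sub_left (mul_le_mul_of_nonneg_right ?_ T.nuclearNorm_nonneg) _)
      (hω.2 T hT)⟩
  · exact (le_add_of_nonneg_right (by positivity)).trans hq
  · refine (le_add_of_nonneg_left ?_).trans hq
    positivity

end GoodEvent

section Main

variable {d d₃ n : ℕ} {Ω : Type*} [MeasurableSpace Ω] {P : Measure Ω}
  {X : Fin n → Ω → Tensor d d₃} {y ε : Fin n → Ω → ℝ} {B₀ : Tensor d d₃} {σ : ℝ≥0} {ν : ℝ}

theorem hasSubgaussianMGF_of_map_eq_gaussianReal {Z : Ω → ℝ} {v : ℝ≥0}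
    (hZ : AEMeasurable Z P) (h : P.map Z = gaussianReal 0 v) : HasSubgaussianMGF Z v P where
  integrable_exp_mul t := by
    have hint := integrable_exp_mul_gaussianReal (μ := 0) (v := v) t
    rw [← h] at hint
    exact hint.comp_aemeasurable hZ
  mgf_le t := by
    rw [mgf_gaussianReal h]
    simp

theorem IsLinearTensorSample.isSubGaussianSample (h : IsLinearTensorSample P X y ε B₀ σ)
    (hX : ∀ i, IsSubGaussianTensor P (X i) ν) : IsSubGaussianSample P X y ε B₀ ν σ where
  measurable_X := h.measurable_X
  measurable_noise := h.measurable_noise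
  response := h.response
  indep := h.indep
  indep_noise := h.indep_noise
  subGaussian_X := hX
  subgaussian_noise i :=
    hasSubgaussianMGF_of_map_eq_gaussianReal (h.measurable_noise i).aemeasurable
      (h.gaussian_noise i)

theorem mainTheorem7_general [IsProbabilityMeasure P]
    (h : IsSubGaussianSample P X y ε B₀ ν σ) (hν : 0 < ν) (hd : 0 < d) (hd₃ : 0 < d₃)
    {r : ℕ} (hr : B₀.tubalRank ≤ r) {κ : ℝ} (hκ : 0 < κ)
    (hmin : κ ≤ minEigenvalue (populationHessian P X)) {β A : ℝ} (hβ : 0 < β) (hA : 0 < A)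
    (hdn : d / β ^ 2 ≤ n) {lam μ Cρ : ℝ} {ρ : ℝ → ℝ} (hCρ : 0 < Cρ) (hρ : IsPenalty ρ lam μ Cρ)
    (hμ : 3 * μ < 2 * minEigenvalue (populationHessian P X))
    (hlam : 4 / Cρ * errorRate σ ν κ β A * √((d : ℝ) * d₃ / n) ≤ lam) :
    ∃ E : Set Ω, MeasurableSet E ∧ 1 - (d₃ : ℝ) * Real.exp (-(A * d)) ≤ P.real E ∧
      ∀ ω ∈ E, ∀ B : Tensor d d₃,
        IsStationaryPoint (objective (fun i => X i ω) (fun i => y i ω) ρ) B →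
        ‖B - B₀‖ ≤ β →
          ‖B - B₀‖ ≤
            54 * (Cρ * lam * √(r : ℝ)) / (2 * minEigenvalue (populationHessian P X) - 3 * μ) ∧
          (B - B₀).nuclearNorm ≤
            54 * (Cρ * lam * r) / (2 * minEigenvalue (populationHessian P X) - 3 * μ) ∧
          meanSquare (fun i => X i ω) (B - B₀) ≤
            Cρ ^ 2 * lam ^ 2 * r *
              (81 / (2 * minEigenvalue (populationHessian P X) - 3 * μ) +
                81 * μ / (2 * minEigenvalue (populationHessian P X) - 3 * μ) ^ 2) := by
  set Λ := minEigenvalue (populationHessian P X)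
  have hn : 0 < n := Nat.cast_pos.1 ((show (0 : ℝ) < d / β ^ 2 by positivity).trans_le hdn)
  have hrate : 0 < errorRate σ ν κ β A := errorRate_pos σ.2 hν hβ hA
  have hslope : errorRate σ ν κ β A * √((d : ℝ) * d₃ / n) ≤ lam * Cρ / 4 := by
    rw [div_mul_eq_mul_div, div_mul_eq_mul_div, div_le_iff₀ hCρ] at hlam
    linarith
  have hL : 0 < lam * Cρ := by
    have := lt_of_lt_of_le (by positivity) hslope
    linarith
  obtain ⟨E, hE, hPE, hgood⟩ := h.exists_goodEvent hν hd hd₃ (hκ.trans_le hmin) le_rfl hA hβ hdn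
    ((mul_le_mul_of_nonneg_right (errorRate_anti hκ hmin hν hβ hA) (by positivity)).trans hslope)
  refine ⟨E, hE, hPE, fun ω hω B hB hBβ => ?_⟩
  obtain ⟨hnoise, hcurv⟩ := hgood ω hω (B - B₀) hBβ
  obtain ⟨hnorm, hnuc, hpred⟩ :=
    hB.error_bounds hρ hL (fun i => h.response i ω) hr hμ hnoise hcurv
  have hgap : 0 < 2 * Λ - 3 * μ := sub_pos.2 hμ
  rw [Real.sq_sqrt r.cast_nonneg] at hnuc hpred
  rw [mul_comm Cρ lam, ← mul_pow, mul_comm Cρ lam]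
  refine ⟨hnorm.trans ?_, hnuc, hpred.trans ?_⟩ <;> gcongr <;> norm_num

end Main

theorem mainTheorem7 :
    ∃ C : ℝ, 0 < C ∧ ∃ c : ℝ, 0 < c ∧
    ∀ (ν κ Cρ : ℝ) (σ : ℝ≥0), 0 < ν → 0 < κ → 0 < Cρ →
    ∃ C₁ : ℝ, 0 < C₁ ∧
    ∀ β A : ℝ, 0 < β → 0 < A →
    ∃ c₀ : ℝ, 0 < c₀ ∧
    ∀ (d d₃ n r : ℕ), 0 < d → 0 < d₃ → 0 < n → 0 < r →
    ∀ (B₀ : Tensor d d₃), B₀.tubalRank = r →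
    ∀ (Ω : Type*) [MeasurableSpace Ω] (P : Measure Ω) [IsProbabilityMeasure P]
      (X : Fin n → Ω → Tensor d d₃) (y ε : Fin n → Ω → ℝ),
      IsLinearTensorSample P X y ε B₀ σ →
      (∀ i, IsSubGaussianTensor P (X i) ν) →
      κ ≤ minEigenvalue (populationHessian P X) →
    ∀ (lam μ : ℝ) (ρ : ℝ → ℝ), IsPenalty ρ lam μ Cρ →
      3 * μ < 2 * minEigenvalue (populationHessian P X) →
      c₀ * √((d : ℝ) * d₃ / n) ≤ lam →
      C₁ * r * d * d₃ / β ^ 2 ≤ (n : ℝ) →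
    ∃ E : Set Ω, MeasurableSet E ∧ 1 - (d₃ : ℝ) * Real.exp (-(A * d)) ≤ P.real E ∧
      ∀ ω ∈ E, ∀ B : Tensor d d₃,
        IsStationaryPoint (objective (fun i => X i ω) (fun i => y i ω) ρ) B →
        ‖B - B₀‖ ≤ β →
          ‖B - B₀‖ ≤
            C * (Cρ * lam * √(r : ℝ)) / (2 * minEigenvalue (populationHessian P X) - 3 * μ) ∧
          (B - B₀).nuclearNorm ≤
            C * (Cρ * lam * r) / (2 * minEigenvalue (populationHessian P X) - 3 * μ) ∧
          (1 / (n : ℝ)) * ∑ i, (⟪X i ω, B - B₀⟫) ^ 2 ≤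
            Cρ ^ 2 * lam ^ 2 * r *
              (c / (2 * minEigenvalue (populationHessian P X) - 3 * μ) +
                c * μ / (2 * minEigenvalue (populationHessian P X) - 3 * μ) ^ 2) := by
  refine ⟨54, by norm_num, 81, by norm_num, fun ν κ Cρ σ hν hκ hCρ => ⟨1, one_pos,
    fun β A hβ hA => ⟨4 / Cρ * errorRate σ ν κ β A,
      mul_pos (by positivity) (errorRate_pos σ.2 hν hβ hA), ?_⟩⟩⟩
  intro d d₃ n r hd hd₃ _ hr B₀ hB₀ Ω _ P _ X y ε hS hX hmin lam μ ρ hρ hμ hlam hn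
  refine mainTheorem7_general (hS.isSubGaussianSample hX) hν hd hd₃ hB₀.le hκ hmin hβ hA
    (le_trans ?_ hn) hCρ hρ hμ hlam
  have hr1 : (1 : ℝ) ≤ r := by exact_mod_cast hr
  have hd₃1 : (1 : ℝ) ≤ d₃ := by exact_mod_cast hd₃
  calc (d : ℝ) / β ^ 2 = 1 * 1 * d * 1 / β ^ 2 := by ring
    _ ≤ 1 * r * d * d₃ / β ^ 2 := by gcongr
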